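/- Let $\mathbb X\subset\mathbb R^d$ be a Borel set (state space) and $\mathbb U\subset\mathbb R^m$ a compact set (action space). Let $c:\mathbb X\times\mathbb U\to\mathbb R$ be continuous and bounded, and let $\mathcal T$ and $\mathcal T_n$ ($n\in\mathbb N$) be stochastic kernels from $\mathbb X\times\mathbb U$ to $\mathbb X$. An admissible policy $\gamma=(\gamma_t)_{t\ge 0}$ chooses $U_t=\gamma_t(X_0,\dots,X_t,U_0,\dots,U_{t-1})$ with measurable maps $\gamma_t$; a stationary policy is a measurable map $\gamma:\mathbb X\to\mathbb U$, used as $U_t=\gamma(X_t)$. For a kernel $\mathcal S$, an admissible policy $\gamma$ and an initial state $x$ put $$J_\infty(\mathcal S,\gamma,x)=\limsup_{N\to\infty}\frac1N E_x^{\mathcal S,\gamma}\Big[\sum_{t=0}^{N-1}c(X_t,U_t)\Big],\qquad J_\infty^*(\mathcal S,x)=\inf_\gamma J_\infty(\mathcal S,\gamma,x),$$ the infimum being over all admissible policies. For a stationary policy $\gamma$ let $\mathcal S^t(\cdot|x,\gamma)$ be the $t$-step transition kernel of the chain with kernel $\mathcal S(\cdot|x,\gamma(x))$, and let $\|\mu-\nu\|_{TV}=\sup_{\|f\|_\infty\le1}|\int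 f\,d\mu-\int f\,d\nu|$ (supremum over measurable $f$). Assume: 1. (Uniform ergodicity) There are an integer $t\ge1$ and $\beta\in(0,1)$ with $\|\mathcal T^t(\cdot|x,\gamma)-\mathcal T^t(\cdot|x',\gamma)\|_{TV}\le2\beta$ for all $x,x'\in\mathbb X$ and all stationary $\gamma$; and there are an integer $t'\ge1$ and $\beta'\in(0,1)$, not depending on $n$, with $\|\mathcal T_n^{t'}(\cdot|x,\gamma)-\mathcal T_n^{t'}(\cdot|x',\gamma)\|_{TV}\le2\beta'$ for all $n$, all $x,x'\in\mathbb X$ and all stationary $\gamma$. 2. $\mathcal T(\cdot|x,u)$ is weakly continuous in $(x,u)$. 3. $\mathcal T_n(\cdot|x_n,u_n)\to\mathcal T(\cdot|x,u)$ weakly whenever $(x_n,u_n)\to(x,u)$ in $\mathbb X\times\mathbb U$. 4. For each $n$, $\gamma_n^*$ is a stationary policy that satisfies the average cost optimality equation (ACOE) of $\mathcal T_n$: there are a constant $j_n^*$ and a bounded measurable $v_n^*:\mathbb X\to\mathbb R$ such that for every $x\in\mathbb X$ $$j_n^*+v_n^*(x)=\inf_{u\in\mathbb U}\Big(c(x,u)+\int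 v_n^*(y)\,\mathcal T_n(dy|x,u)\Big)=c(x,\gamma_n^*(x))+\int v_n^*(y)\,\mathcal T_n(dy|x,\gamma_n^*(x)).$$ Then $J_\infty(\mathcal T,\gamma_n^*,x)\to J_\infty^*(\mathcal T,x)$ as $n\to\infty$, for every $x\in\mathbb X$. -/

import Mathlib

open MeasureTheory ProbabilityTheory Filter Topology

noncomputable section

/-- An admissible policy: at time `t` the action is a measurable function of the information
`(x_0, …, x_t, u_0, …, u_{t-1})`. -/
structure AdmissiblePolicy (X U : Type*) [MeasurableSpace X] [MeasurableSpace U] where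
  act : ∀ t : ℕ, (Fin (t + 1) → X) × (Fin t → U) → U
  measurable_act : ∀ t, Measurable (act t)

/-- A stationary policy: one measurable function of the current state. -/
structure StationaryPolicy (X U : Type*) [MeasurableSpace X] [MeasurableSpace U] where
  act : X → U
  measurable_act : Measurable act

section

variable {X U : Type*} [MeasurableSpace X] [MeasurableSpace U]

/-- A stationary policy viewed as an admissible policy. -/
def StationaryPolicy.toAdmissible (γ : StationaryPolicy X U) : AdmissiblePolicy X U where
  act t h := γ.act (h.1 (Fin.last t))
  measurable_act t :=
    γ.measurable_act.comp ((measurable_pi_apply (Fin.last t)).comp measurable_fst)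

/-- The current state together with the action chosen from the history. -/
lemma AdmissiblePolicy.measurable_stateAction (γ : AdmissiblePolicy X U) (t : ℕ) :
    Measurable fun h : (Fin (t + 1) → X) × (Fin t → U) => (h.1 (Fin.last t), γ.act t h) :=
  ((measurable_pi_apply (Fin.last t)).comp measurable_fst).prodMk (γ.measurable_act t)

/-- The joint law of `(X_0, …, X_t, U_0, …, U_{t-1})` when `X_0 = x`, the actions are chosen by
`γ`, and given the past the next state has law `T(· | X_t, U_t)`. -/
def historyLaw (T : Kernel (X × U) X) (γ : AdmissiblePolicy X U) (x : X) :
    (t : ℕ) → Measure ((Fin (t + 1) → X) × (Fin t → U))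
  | 0 => Measure.dirac (fun _ => x, Fin.elim0)
  | t + 1 =>
      ((historyLaw T γ x t) ⊗ₘ (T.comap _ (γ.measurable_stateAction t))).map
        fun p => (Fin.snoc (α := fun _ => X) p.1.1 p.2,
          Fin.snoc (α := fun _ => U) p.1.2 (γ.act t p.1))

/-- The expected total cost over the first `N` stages, started at `x`. -/
def expectedCost (c : X × U → ℝ) (T : Kernel (X × U) X) (γ : AdmissiblePolicy X U) (x : X)
    (N : ℕ) : ℝ :=
  ∫ h, ∑ t : Fin N, c (h.1 t.castSucc, h.2 t) ∂(historyLaw T γ x N)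

/-- The infinite-horizon average expected cost `J_∞(T, γ, x)`. -/
def averageCost (c : X × U → ℝ) (T : Kernel (X × U) X) (γ : AdmissiblePolicy X U) (x : X) : ℝ :=
  limsup (fun N : ℕ => (1 / (N : ℝ)) * expectedCost c T γ x N) atTop

/-- The optimal average cost `J_∞^*(T, x)`, the infimum over all admissible policies. -/
def optimalAverageCost (c : X × U → ℝ) (T : Kernel (X × U) X) (x : X) : ℝ :=
  ⨅ γ : AdmissiblePolicy X U, averageCost c T γ x

/-- The `t`-step transition kernel `T^t(· | x, γ)` under a stationary policy. -/
def stepKernel (T : Kernel (X × U) X) (γ : StationaryPolicy X U) : ℕ → Kernel X X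
  | 0 => Kernel.id
  | t + 1 =>
      (T.comap (fun x => (x, γ.act x)) (measurable_id.prodMk γ.measurable_act)) ∘ₖ
        (stepKernel T γ t)

/-- The total variation distance `sup_{‖f‖_∞ ≤ 1} |∫ f dμ - ∫ f dν|`, which takes values in
`[0, 2]` on probability measures. -/
def tvDist (μ ν : Measure X) : ℝ :=
  sSup {r : ℝ | ∃ f : X → ℝ, Measurable f ∧ (∀ x, |f x| ≤ 1) ∧
    r = |∫ x, f x ∂μ - ∫ x, f x ∂ν|}

/-- Uniform ergodicity of a family of controlled kernels: for some `t ≥ 1` and `0 < β < 1`,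
`‖T_i^t(· | x, γ) - T_i^t(· | x', γ)‖_TV ≤ 2 β` for all members `T_i` of the family, all
stationary policies `γ` and all states `x, x'`. -/
def UniformlyErgodic {ι : Type*} (T : ι → Kernel (X × U) X) : Prop :=
  ∃ t : ℕ, 0 < t ∧ ∃ β : ℝ, 0 < β ∧ β < 1 ∧
    ∀ (i : ι) (γ : StationaryPolicy X U) (x x' : X),
      tvDist (stepKernel (T i) γ t x) (stepKernel (T i) γ t x') ≤ 2 * β

/-- The operator `(Tv)(x) = inf_u (c(x,u) + ∫ v(y) T(dy | x,u))`. -/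
def bellman (c : X × U → ℝ) (T : Kernel (X × U) X) (v : X → ℝ) (x : X) : ℝ :=
  ⨅ u : U, (c (x, u) + ∫ y, v y ∂(T (x, u)))

/-- The stationary policy `γ` satisfies the average cost optimality equation of `T`: for some
constant `j` and some bounded measurable `v`, `j + v(x) = inf_u (c(x,u) + ∫ v dT(· | x,u))` for
every `x`, and the infimum is attained at `u = γ(x)`. -/
def SatisfiesACOE (c : X × U → ℝ) (T : Kernel (X × U) X) (γ : StationaryPolicy X U) : Prop :=
  ∃ (j : ℝ) (v : X → ℝ), Measurable v ∧ (∃ K : ℝ, ∀ x, |v x| ≤ K) ∧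
    ∀ x, j + v x = bellman c T v x ∧
      j + v x = c (x, γ.act x) + ∫ y, v y ∂(T (x, γ.act x))

/-- The value `T(· | x,u)` of a Markov kernel, as a point of the space of probability measures
with the topology of weak convergence. -/
def kernelProb (T : Kernel (X × U) X) [IsMarkovKernel T] (p : X × U) : ProbabilityMeasure X :=
  ⟨T p, inferInstance⟩

end

end

/-! Nothing makes the policies `γn n` or the solutions `v n` of their optimality equations converge,
and weak convergence only tests continuous functions. So the equation of `Tn n` is compared with an
approximate equation of `T` that has a continuous solution. Uniform ergodicity bounds the span of
discounted solutions independently of the discount (`osc_le_of_poisson`). A discount close to 1 and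
Banach's fixed point theorem then give a constant `r`, a continuous `h` and a policy `g` solving the
equation of `T` up to `ε` (`exists_approx_ACOE`).

Take an ultrafilter `L` finer than `atTop` and put `w n = v n - h`. Along `L`, up to O(ε) and
locally uniformly in the state, `w n` is a submartingale for `Tn n` under `g` and a supermartingale
under `γn n`. The comparison principle `asympSup_add_asympSup_neg_le` shows that its asymptotic
range then has length O(ε): let one policy follow `g` above the middle of the range and `γn n` below
it. Started near the top, the chain stays near the top in mean for a fixed number of steps, and
likewise at the bottom; but that many steps contract the range by a factor below 1.

Hence `γn n` solves the equation of `T` with `h` up to O(ε), locally uniformly in the state. Mixing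
of `T` makes this uniform at late times, so the average cost is at most `r` + O(ε)
(`averageCost_le_of_defect`), while `r - ε` bounds every policy from below
(`le_averageCost_of_subsolution`).

The substitute for convergence is `IsAsympUpperBound`: a one-sided bound on open sets survives
integration against weakly convergent measures, by the portmanteau inequality, and uniformly in the
action, by compactness. It therefore passes through arbitrary measurable policies. -/

/-- `f` is measurable and bounded by `K` in absolute value. -/
structure BddMeasurable {X : Type*} [MeasurableSpace X] (K : ℝ) (f : X → ℝ) : Prop where
  measurable : Measurable f
  bound : ∀ x, |f x| ≤ K

/-- The one-step expectation operator of the chain driven by a stationary policy. -/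
noncomputable def policyAvg {X U : Type*} [MeasurableSpace X] [MeasurableSpace U]
    (T : Kernel (X × U) X) (γ : StationaryPolicy X U) (f : X → ℝ) : X → ℝ :=
  fun x => ∫ y, f y ∂(T (x, γ.act x))

/-! ### Averaging operators, total variation and contraction of the span -/

section Averages

variable {X U : Type*} [MeasurableSpace X] [MeasurableSpace U]

namespace BddMeasurable

lemma integrable {K : ℝ} {f : X → ℝ} (hf : BddMeasurable K f) (μ : Measure X)
    [IsFiniteMeasure μ] : Integrable f μ :=
  Integrable.of_bound hf.measurable.aestronglyMeasurable K
    (Eventually.of_forall fun x => by simpa using hf.bound x)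

lemma neg {K : ℝ} {f : X → ℝ} (hf : BddMeasurable K f) : BddMeasurable K (fun x => -f x) :=
  ⟨hf.measurable.neg, fun x => by simpa using hf.bound x⟩

lemma add {K K' : ℝ} {f g : X → ℝ} (hf : BddMeasurable K f) (hg : BddMeasurable K' g) :
    BddMeasurable (K + K') (fun x => f x + g x) :=
  ⟨hf.measurable.add hg.measurable,
    fun x => (abs_add_le _ _).trans (add_le_add (hf.bound x) (hg.bound x))⟩

lemma sub {K K' : ℝ} {f g : X → ℝ} (hf : BddMeasurable K f) (hg : BddMeasurable K' g) :
    BddMeasurable (K + K') (fun x => f x - g x) := by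
  simpa [sub_eq_add_neg] using hf.add hg.neg

lemma const (r : ℝ) : BddMeasurable |r| (fun _ : X => r) :=
  ⟨measurable_const, fun _ => le_rfl⟩

lemma const_mul {K : ℝ} {f : X → ℝ} (hf : BddMeasurable K f) (r : ℝ) :
    BddMeasurable (|r| * K) (fun x => r * f x) :=
  ⟨hf.measurable.const_mul r, fun x => by
    rw [abs_mul]; exact mul_le_mul_of_nonneg_left (hf.bound x) (abs_nonneg r)⟩

lemma integral_abs_le {K : ℝ} {f : X → ℝ} (hf : BddMeasurable K f) (μ : Measure X)
    [IsProbabilityMeasure μ] : |∫ x, f x ∂μ| ≤ K := by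
  have := norm_integral_le_of_norm_le_const (μ := μ) (f := f) (C := K)
    (Eventually.of_forall fun x => by simpa using hf.bound x)
  simpa using this

lemma le_integral {K a : ℝ} {f : X → ℝ} (hf : BddMeasurable K f) (μ : Measure X)
    [IsProbabilityMeasure μ] (h : ∀ x, a ≤ f x) : a ≤ ∫ x, f x ∂μ := by
  simpa using integral_mono (integrable_const a) (hf.integrable μ) h

lemma integral_le {K a : ℝ} {f : X → ℝ} (hf : BddMeasurable K f) (μ : Measure X)
    [IsProbabilityMeasure μ] (h : ∀ x, f x ≤ a) : ∫ x, f x ∂μ ≤ a := by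
  simpa using integral_mono (hf.integrable μ) (integrable_const a) h

variable (T : Kernel (X × U) X) [IsMarkovKernel T] (γ : StationaryPolicy X U)

lemma integral_kernel {K : ℝ} {f : X → ℝ} (hf : BddMeasurable K f) :
    BddMeasurable K (fun p : X × U => ∫ y, f y ∂(T p)) :=
  ⟨(hf.measurable.stronglyMeasurable.integral_kernel (κ := T)).measurable,
    fun p => hf.integral_abs_le (T p)⟩

lemma policyAvg {K : ℝ} {f : X → ℝ} (hf : BddMeasurable K f) :
    BddMeasurable K (policyAvg T γ f) :=
  ⟨(hf.integral_kernel T).measurable.comp (measurable_id.prodMk γ.measurable_act),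
    fun x => hf.integral_abs_le (T (x, γ.act x))⟩

lemma policyAvg_iterate {K : ℝ} {f : X → ℝ} (hf : BddMeasurable K f) (k : ℕ) :
    BddMeasurable K ((_root_.policyAvg T γ)^[k] f) := by
  induction k with
  | zero => simpa using hf
  | succ k ih => rw [Function.iterate_succ_apply']; exact ih.policyAvg T γ

end BddMeasurable

section

variable (T : Kernel (X × U) X) [IsMarkovKernel T] (γ : StationaryPolicy X U)

lemma policyAvg_add {K K' : ℝ} {f g : X → ℝ} (hf : BddMeasurable K f) (hg : BddMeasurable K' g) :
    policyAvg T γ (fun x => f x + g x) = fun x => policyAvg T γ f x + policyAvg T γ g x :=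
  funext fun _ => integral_add (hf.integrable _) (hg.integrable _)

lemma policyAvg_sub {K K' : ℝ} {f g : X → ℝ} (hf : BddMeasurable K f) (hg : BddMeasurable K' g) :
    policyAvg T γ (fun x => f x - g x) = fun x => policyAvg T γ f x - policyAvg T γ g x :=
  funext fun _ => integral_sub (hf.integrable _) (hg.integrable _)

omit [IsMarkovKernel T] in
lemma policyAvg_neg (f : X → ℝ) :
    policyAvg T γ (fun x => -f x) = fun x => -policyAvg T γ f x :=
  funext fun _ => integral_neg _

omit [IsMarkovKernel T] in
lemma policyAvg_const_mul (r : ℝ) (f : X → ℝ) :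
    policyAvg T γ (fun x => r * f x) = fun x => r * policyAvg T γ f x :=
  funext fun _ => integral_const_mul _ _

lemma policyAvg_const (r : ℝ) : policyAvg T γ (fun _ => r) = fun _ => r :=
  funext fun _ => by simp [policyAvg]

lemma policyAvg_iterate_const (r : ℝ) (k : ℕ) : (policyAvg T γ)^[k] (fun _ => r) = fun _ => r :=
  Function.iterate_fixed (policyAvg_const T γ r) k

lemma policyAvg_iterate_sub {K K' : ℝ} {f g : X → ℝ} (hf : BddMeasurable K f)
    (hg : BddMeasurable K' g) (k : ℕ) :
    (policyAvg T γ)^[k] (fun x => f x - g x) =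
      fun x => (policyAvg T γ)^[k] f x - (policyAvg T γ)^[k] g x := by
  induction k generalizing f g with
  | zero => rfl
  | succ k ih =>
    rw [Function.iterate_succ_apply, policyAvg_sub T γ hf hg,
      ih (hf.policyAvg T γ) (hg.policyAvg T γ)]
    rfl

omit [IsMarkovKernel T] in
lemma policyAvg_iterate_neg (f : X → ℝ) (k : ℕ) :
    (policyAvg T γ)^[k] (fun x => -f x) = fun x => -(policyAvg T γ)^[k] f x := by
  induction k generalizing f with
  | zero => rfl
  | succ k ih => rw [Function.iterate_succ_apply, policyAvg_neg, ih]; rfl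

instance stepKernel_isMarkov (k : ℕ) : IsMarkovKernel (stepKernel T γ k) := by
  induction k with
  | zero => rw [stepKernel]; infer_instance
  | succ k ih => rw [stepKernel]; infer_instance

lemma integral_stepKernel {K : ℝ} {f : X → ℝ} (hf : BddMeasurable K f) (k : ℕ) (x : X) :
    ∫ y, f y ∂(stepKernel T γ k x) = (policyAvg T γ)^[k] f x := by
  induction k generalizing f with
  | zero => simp [stepKernel, Kernel.id_apply, integral_dirac' f x hf.measurable.stronglyMeasurable]
  | succ k ih =>
    rw [Function.iterate_succ_apply, ← ih (hf.policyAvg T γ), stepKernel,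
      Kernel.integral_comp (hf.integrable _)]
    rfl

omit [MeasurableSpace U] in
lemma abs_integral_sub_le_tvDist {μ ν : Measure X} [IsProbabilityMeasure μ]
    [IsProbabilityMeasure ν] {R : ℝ} {f : X → ℝ} (hf : BddMeasurable R f) :
    |∫ x, f x ∂μ - ∫ x, f x ∂ν| ≤ R * tvDist μ ν := by
  rcases le_or_gt R 0 with hR | hR
  · have h0 : f = fun _ => 0 := funext fun x =>
      abs_eq_zero.mp (le_antisymm ((hf.bound x).trans hR) (abs_nonneg _))
    by_cases hX : Nonempty X
    · obtain ⟨x⟩ := hX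
      have : R = 0 := le_antisymm hR ((abs_nonneg _).trans (hf.bound x))
      simp [h0, this]
    · have := not_nonempty_iff.mp hX
      exact absurd (Measure.eq_zero_of_isEmpty μ) (IsProbabilityMeasure.ne_zero μ)
  · have hg : BddMeasurable 1 (fun x => R⁻¹ * f x) := by
      refine ⟨hf.measurable.const_mul _, fun x => ?_⟩
      rw [abs_mul, abs_of_pos (inv_pos.mpr hR), inv_mul_le_iff₀ hR, mul_one]
      exact hf.bound x
    have hle : |∫ x, R⁻¹ * f x ∂μ - ∫ x, R⁻¹ * f x ∂ν| ≤ tvDist μ ν := by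
      -- A real supremum is only meaningful with a bound; 2 works for probability measures.
      refine le_csSup ⟨2, ?_⟩ ⟨_, hg.measurable, hg.bound, rfl⟩
      rintro r ⟨g, hgm, hgb, rfl⟩
      have hg' : BddMeasurable 1 g := ⟨hgm, hgb⟩
      have h1 := hg'.integral_abs_le μ
      have h2 := hg'.integral_abs_le ν
      exact (abs_sub _ _).trans (by linarith)
    rw [integral_const_mul, integral_const_mul, ← mul_sub, abs_mul,
      abs_of_pos (inv_pos.mpr hR), inv_mul_le_iff₀ hR] at hle
    exact hle

/-- A total variation bound makes the `t`-step expectation operator a contraction in span. -/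
lemma abs_policyAvg_iterate_sub_le {t : ℕ} {β : ℝ} {x x' : X}
    (htv : tvDist (stepKernel T γ t x) (stepKernel T γ t x') ≤ 2 * β)
    {a D : ℝ} {f : X → ℝ} (hfm : Measurable f) (hD : 0 ≤ D) (hf : ∀ x, a ≤ f x ∧ f x ≤ a + D) :
    |(policyAvg T γ)^[t] f x - (policyAvg T γ)^[t] f x'| ≤ β * D := by
  -- Centring at the midpoint halves the sup norm, which cancels the 2 in `2 * β`.
  have hg : BddMeasurable (D / 2) (fun y => f y - (a + D / 2)) :=
    ⟨hfm.sub_const _, fun y => abs_le.mpr ⟨by linarith [(hf y).1], by linarith [(hf y).2]⟩⟩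
  have hf' : BddMeasurable (D / 2 + |a + D / 2|) f := by
    simpa using hg.add (BddMeasurable.const (a + D / 2))
  have h := abs_integral_sub_le_tvDist (μ := stepKernel T γ t x) (ν := stepKernel T γ t x') hg
  rw [integral_stepKernel T γ hg, integral_stepKernel T γ hg,
    policyAvg_iterate_sub T γ hf' (BddMeasurable.const _), policyAvg_iterate_const] at h
  have h2 : D / 2 * tvDist (stepKernel T γ t x) (stepKernel T γ t x') ≤ D / 2 * (2 * β) :=
    mul_le_mul_of_nonneg_left htv (by linarith)
  calc _ = _ := by ring_nf
    _ ≤ _ := h.trans h2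
    _ = _ := by ring

/-- The span-contraction form used below: only pairwise differences of `f` enter. -/
lemma abs_policyAvg_iterate_sub_le_of_osc {t : ℕ} {β : ℝ} {x x' : X}
    (htv : tvDist (stepKernel T γ t x) (stepKernel T γ t x') ≤ 2 * β)
    {K D : ℝ} {f : X → ℝ} (hfm : BddMeasurable K f) (hf : ∀ x x', |f x - f x'| ≤ D) :
    |(policyAvg T γ)^[t] f x - (policyAvg T γ)^[t] f x'| ≤ β * D := by
  have : Nonempty X := ⟨x⟩
  have hbdd : BddBelow (Set.range f) := ⟨-K, by rintro _ ⟨y, rfl⟩; exact (abs_le.mp (hfm.bound y)).1⟩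
  refine abs_policyAvg_iterate_sub_le T γ htv (a := ⨅ y, f y) hfm.measurable
    ((abs_nonneg _).trans (hf x x)) fun y => ⟨ciInf_le hbdd y, ?_⟩
  have : f y - D ≤ ⨅ y, f y := le_ciInf fun z => by linarith [(abs_le.mp (hf y z)).2]
  linarith

/-- Iterating the span contraction. -/
lemma abs_policyAvg_iterate_mul_sub_le {t : ℕ} {β : ℝ}
    (htv : ∀ x x', tvDist (stepKernel T γ t x) (stepKernel T γ t x') ≤ 2 * β)
    {K D : ℝ} {f : X → ℝ} (hfm : BddMeasurable K f) (hf : ∀ x x', |f x - f x'| ≤ D)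
    (k : ℕ) (x x' : X) :
    |(policyAvg T γ)^[t * k] f x - (policyAvg T γ)^[t * k] f x'| ≤ β ^ k * D := by
  induction k generalizing x x' with
  | zero => simpa using hf x x'
  | succ k ih =>
    rw [Nat.mul_succ, Nat.add_comm, Function.iterate_add_apply, pow_succ', mul_assoc]
    exact abs_policyAvg_iterate_sub_le_of_osc T γ (htv x x') (hfm.policyAvg_iterate T γ _) ih

/-- A solution of a (discounted) Poisson equation has span controlled by the forcing term and the
rate of ergodicity. -/
lemma osc_le_of_poisson {t : ℕ} {β : ℝ} (hβ1 : β < 1)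
    (htv : ∀ x x', tvDist (stepKernel T γ t x) (stepKernel T γ t x') ≤ 2 * β)
    {α C m K : ℝ} (hα : 0 ≤ α) (hα1 : α ≤ 1) {f q : X → ℝ}
    (hf : BddMeasurable K f) (hq : ∀ x, |q x - m| ≤ C)
    (hfq : ∀ x, f x = q x + α * policyAvg T γ f x) (x x' : X) :
    |f x - f x'| ≤ 2 * t * C / (1 - β) := by
  -- Unrolling the equation `k` times: each pass adds a constant and an error of at most `C`.
  have step : ∀ k : ℕ, ∃ mk : ℝ, ∀ x, |f x - α ^ k * (policyAvg T γ)^[k] f x - mk| ≤ k * C := by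
    intro k
    induction k with
    | zero => exact ⟨0, fun x => by simp⟩
    | succ k ih =>
      obtain ⟨mk, hmk⟩ := ih
      refine ⟨m + α * mk, fun x => ?_⟩
      have hg1 := (hf.policyAvg_iterate T γ k).const_mul (α ^ k)
      have hg : BddMeasurable (k * C)
          (fun x => (f x - α ^ k * (policyAvg T γ)^[k] f x) - mk) :=
        ⟨((hf.sub hg1).sub (BddMeasurable.const mk)).measurable, hmk⟩
      have h1 := (hg.policyAvg T γ).bound x
      rw [policyAvg_sub T γ (hf.sub hg1) (BddMeasurable.const mk), policyAvg_const,
        policyAvg_sub T γ hf hg1, policyAvg_const_mul] at h1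
      have h2 := hq x
      rw [hfq x, Function.iterate_succ_apply', pow_succ]
      set A := policyAvg T γ f x
      set B := policyAvg T γ ((policyAvg T γ)^[k] f) x
      have h3 : |α * (A - α ^ k * B - mk)| ≤ k * C := by
        rw [abs_mul, abs_of_nonneg hα]
        exact (mul_le_of_le_one_left (abs_nonneg _) hα1).trans h1
      calc |q x + α * A - α ^ k * α * B - (m + α * mk)|
          = |(q x - m) + α * (A - α ^ k * B - mk)| := by ring_nf
        _ ≤ C + k * C := (abs_add_le _ _).trans (add_le_add h2 h3)
        _ = ((k + 1 : ℕ) : ℝ) * C := by push_cast; ring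
  obtain ⟨mt, hmt⟩ := step t
  have : Nonempty X := ⟨x⟩
  set D := ⨆ p : X × X, |f p.1 - f p.2| with hDdef
  have hbdd : BddAbove (Set.range fun p : X × X => |f p.1 - f p.2|) :=
    ⟨K + K, by rintro _ ⟨p, rfl⟩; exact (abs_sub _ _).trans (add_le_add (hf.bound _) (hf.bound _))⟩
  have hfD : ∀ y y', |f y - f y'| ≤ D := fun y y' => le_ciSup hbdd (y, y')
  have hD0 : 0 ≤ D := (abs_nonneg _).trans (hfD x x)
  -- At `k = t` the remaining iterate has span at most `β * D`; as `D` is finite and `β < 1`, the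
  -- inequality can be solved for `D`.
  have key : D ≤ 2 * t * C + β * D := by
    refine ciSup_le fun ⟨y, y'⟩ => ?_
    have h1 := hmt y
    have h2 := hmt y'
    have h3 := abs_policyAvg_iterate_sub_le_of_osc T γ (htv y y') hf hfD
    have h4 : |α ^ t * ((policyAvg T γ)^[t] f y - (policyAvg T γ)^[t] f y')| ≤ β * D := by
      rw [abs_mul, abs_of_nonneg (pow_nonneg hα t)]
      exact (mul_le_of_le_one_left (abs_nonneg _) (pow_le_one₀ hα hα1)).trans h3
    rw [abs_le] at *
    constructor <;> nlinarith
  refine (hfD x x').trans ?_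
  rw [le_div_iff₀ (by linarith)]
  linarith

end

end Averages

/-! ### Asymptotic upper bounds -/

/-- Locally uniformly in the state, `a` is an upper bound of `f n` in the limit along `L`. -/
def IsAsympUpperBound {X : Type*} [TopologicalSpace X] (L : Filter ℕ) (f : ℕ → X → ℝ) (a : ℝ) :
    Prop :=
  ∀ x, ∀ ε > 0, ∀ᶠ p : ℕ × X in L ×ˢ 𝓝 x, f p.1 p.2 < a + ε

/-- The kernels `Tn n` converge continuously to `T` along `L`, in the weak topology. -/
def KernelsConvergeContinuously {X U : Type*} [MeasurableSpace X] [MeasurableSpace U]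
    [TopologicalSpace X] [OpensMeasurableSpace X] [TopologicalSpace U] (L : Filter ℕ)
    (Tn : ℕ → Kernel (X × U) X) [∀ n, IsMarkovKernel (Tn n)]
    (T : Kernel (X × U) X) [IsMarkovKernel T] : Prop :=
  ∀ p, Tendsto (fun q : ℕ × (X × U) => kernelProb (Tn q.1) q.2) (L ×ˢ 𝓝 p)
    (𝓝 (kernelProb T p))

namespace IsAsympUpperBound

variable {X : Type*} [TopologicalSpace X] {L : Filter ℕ} {f g : ℕ → X → ℝ} {a b : ℝ}

lemma mono (hf : IsAsympUpperBound L f a) (hgf : ∀ n x, g n x ≤ f n x) (hab : a ≤ b) :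
    IsAsympUpperBound L g b := fun x ε hε => by
  filter_upwards [hf x ε hε] with p hp
  linarith [hgf p.1 p.2]

lemma add (hf : IsAsympUpperBound L f a) (hg : IsAsympUpperBound L g b) :
    IsAsympUpperBound L (fun n x => f n x + g n x) (a + b) := fun x ε hε => by
  filter_upwards [hf x (ε / 2) (by linarith), hg x (ε / 2) (by linarith)] with p hp hq
  linarith

lemma of_forall_le (hf : ∀ n x, f n x ≤ a) : IsAsympUpperBound L f a := fun x ε hε =>
  Eventually.of_forall fun p => by linarith [hf p.1 p.2]

lemma of_tendsto {r : ℕ → ℝ} (hr : Tendsto r L (𝓝 a)) :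
    IsAsympUpperBound L (fun n (_ : X) => r n) a := fun x ε hε => by
  have h : ∀ᶠ n in L, r n < a + ε := hr.eventually_lt_const (by linarith)
  exact tendsto_fst.eventually h

lemma of_forall_pos (h : ∀ δ > 0, IsAsympUpperBound L f (a + δ)) : IsAsympUpperBound L f a :=
  fun x ε hε => by
    filter_upwards [h (ε / 2) (by linarith) x (ε / 2) (by linarith)] with p hp
    linarith

/-- Restriction to one fixed state. -/
lemma eventually_lt (hf : IsAsympUpperBound L f a) (x : X) {ε : ℝ} (hε : 0 < ε) :
    ∀ᶠ n in L, f n x < a + ε := by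
  have h : Tendsto (fun n => (n, x)) L (L ×ˢ 𝓝 x) :=
    tendsto_id.prodMk (tendsto_const_nhds.mono_right le_rfl)
  exact h.eventually (hf x ε hε)

end IsAsympUpperBound

/-! ### Weak convergence and asymptotic bounds -/

section Weak

variable {X U : Type*} [MeasurableSpace X] [MeasurableSpace U] [TopologicalSpace X]
  [TopologicalSpace U] [BorelSpace X] [SecondCountableTopology X] [HasOuterApproxClosed X]

omit [MeasurableSpace U] [TopologicalSpace U] in
/-- Asymptotic upper bounds pass through integrals against weakly convergent measures. -/
lemma IsAsympUpperBound.eventually_integral_lt {ι : Type*} {F : Filter ι} {L : Filter ℕ}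
    {N : ι → ℕ} (hN : Tendsto N F L) {μ : ι → ProbabilityMeasure X} {ν : ProbabilityMeasure X}
    (hμ : Tendsto μ F (𝓝 ν)) {f : ℕ → X → ℝ} {K a : ℝ} (hf : ∀ n, BddMeasurable K (f n))
    (ha : IsAsympUpperBound L f a) {ε : ℝ} (hε : 0 < ε) :
    ∀ᶠ i in F, ∫ y, f (N i) y ∂(μ i : Measure X) < a + ε := by
  have hX : Nonempty X := by
    by_contra h
    have := not_nonempty_iff.mp h
    exact IsProbabilityMeasure.ne_zero (ν : Measure X) (Measure.eq_zero_of_isEmpty _)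
  obtain ⟨x0⟩ := id hX
  have hK : 0 ≤ K := (abs_nonneg _).trans ((hf 0).bound x0)
  have h1 : ∀ y, ∃ S ∈ L, ∃ V ∈ 𝓝 y, ∀ n ∈ S, ∀ z ∈ V, f n z < a + ε / 2 := by
    intro y
    obtain ⟨S, hS, V, hV, h⟩ := mem_prod_iff.mp (ha y (ε / 2) (by linarith))
    exact ⟨S, hS, V, hV, fun n hn z hz => h (Set.mk_mem_prod hn hz)⟩
  choose S hS V hV hfV using h1
  -- The index set on which the bound holds depends on the state. A countable subcover, cut to a
  -- finite part carrying almost all of `ν`, leaves finitely many index sets to intersect.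
  obtain ⟨s, hs, hcov⟩ := TopologicalSpace.countable_cover_nhds
    (f := fun y => interior (V y)) fun y => interior_mem_nhds.mpr (hV y)
  have hsne : s.Nonempty := by
    by_contra h
    rw [Set.not_nonempty_iff_eq_empty] at h
    have hx := hcov.symm ▸ Set.mem_univ x0
    simp [h] at hx
  obtain ⟨e, rfl⟩ := hs.exists_eq_range hsne
  set G : ℕ → Set X := fun i => interior (V (e i)) with hG
  have hGu : ⋃ i, G i = Set.univ := by
    rw [← hcov]; simp [hG]
  have hlim : Tendsto (fun k => (ν : Measure X) (Set.accumulate G k)) atTop (𝓝 1) := by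
    have := tendsto_measure_iUnion_accumulate (μ := (ν : Measure X)) (f := G)
    rwa [hGu, measure_univ] at this
  -- `M` bounds the excess of `f` over `a + ε / 2` off the good open set, so mass below `η` there
  -- costs less than `ε / 2`.
  set M := K + |a| + ε with hM
  have hMpos : 0 < M := by positivity
  set η := ε / (2 * M) with hη
  have hηpos : 0 < η := by positivity
  have hlt1 : ENNReal.ofReal (1 - η) < 1 := by
    rw [ENNReal.ofReal_lt_one]; linarith
  obtain ⟨k, hk⟩ := (hlim.eventually_const_lt hlt1).exists
  have hopen : IsOpen (Set.accumulate G k) := by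
    rw [Set.accumulate_def]
    exact isOpen_biUnion fun _ _ => isOpen_interior
  have hev := eventually_lt_of_lt_liminf
    (hk.trans_le (ProbabilityMeasure.le_liminf_measure_open_of_tendsto hμ hopen))
  have hSk : ∀ᶠ n in L, ∀ i ∈ Finset.range (k + 1), n ∈ S (e i) :=
    (eventually_all_finset _).mpr fun i _ => hS (e i)
  filter_upwards [hev, hN.eventually hSk] with i hi1 hi2
  set W := Set.accumulate G k with hW
  have hWm : MeasurableSet W := hopen.measurableSet
  have hfW : ∀ z ∈ W, f (N i) z ≤ a + ε / 2 := by
    intro z hz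
    obtain ⟨l, hl, hz⟩ := Set.mem_accumulate.mp hz
    exact (hfV (e l) _ (hi2 l (by simpa [Nat.lt_succ_iff] using hl)) z (interior_subset hz)).le
  have hmu : (μ i : Measure X).real Wᶜ < η := by
    rw [measureReal_compl hWm, probReal_univ]
    have : 1 - η < (μ i : Measure X).real W := by
      rw [← ofReal_measureReal, ENNReal.ofReal_lt_ofReal_iff'] at hi1
      exact hi1.1
    linarith
  have hdom : ∀ z, f (N i) z ≤ (a + ε / 2) + Wᶜ.indicator (fun _ => M) z := by
    intro z
    by_cases hz : z ∈ W
    · simpa [hz] using hfW z hz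
    · have h1 := (abs_le.mp ((hf (N i)).bound z)).2
      have h2 := neg_abs_le a
      simp only [Set.mem_compl_iff, hz, not_false_eq_true, Set.indicator_of_mem]
      linarith
  have hint : Integrable (Wᶜ.indicator fun _ : X => M) (μ i : Measure X) :=
    (integrable_const M).indicator hWm.compl
  calc ∫ y, f (N i) y ∂(μ i : Measure X)
      ≤ ∫ y, ((a + ε / 2) + Wᶜ.indicator (fun _ => M) y) ∂(μ i : Measure X) :=
        integral_mono ((hf _).integrable _) ((integrable_const _).add hint) hdom
    _ = (a + ε / 2) + (μ i : Measure X).real Wᶜ * M := by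
        rw [integral_add (integrable_const _) hint, integral_indicator_const _ hWm.compl]
        simp
    _ < (a + ε / 2) + η * M := by gcongr
    _ = a + ε := by rw [hη]; field_simp; ring

-- The tube lemma: finitely many neighbourhoods of actions cover the compact action space.
omit [MeasurableSpace X] [MeasurableSpace U] [BorelSpace X] [SecondCountableTopology X]
  [HasOuterApproxClosed X] in
lemma eventually_forall_of_compactSpace [CompactSpace U] {L : Filter ℕ} {x : X}
    {P : ℕ × X → U → Prop}
    (h : ∀ u, ∀ᶠ q : ℕ × (X × U) in L ×ˢ 𝓝 (x, u), P (q.1, q.2.1) q.2.2) :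
    ∀ᶠ p in L ×ˢ 𝓝 x, ∀ u, P p u := by
  have h2 : ∀ᶠ q : (ℕ × X) × U in (L ×ˢ 𝓝 x) ×ˢ 𝓝ˢ (Set.univ : Set U), P q.1 q.2 := by
    rw [isCompact_univ.prod_nhdsSet_eq_biSup]
    simp only [eventually_iSup]
    intro u _
    have := h u
    rw [nhds_prod_eq, ← Filter.prod_assoc, eventually_map] at this
    simpa using this
  rw [nhdsSet_univ, ← principal_univ, eventually_prod_principal_iff] at h2
  simpa using h2

variable {L : Filter ℕ} {Tn : ℕ → Kernel (X × U) X} [∀ n, IsMarkovKernel (Tn n)]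
  {T : Kernel (X × U) X} [IsMarkovKernel T]

omit [HasOuterApproxClosed X] [SecondCountableTopology X] in
lemma kernelsConvergeContinuously_const (hT : Continuous (kernelProb T)) :
    KernelsConvergeContinuously L (fun _ => T) T := fun p =>
  (hT.tendsto p).comp tendsto_snd

omit [HasOuterApproxClosed X] [SecondCountableTopology X] in
/-- Continuous convergence, tested on sequences indexed by `n` itself. -/
lemma kernelsConvergeContinuously_of_seq [FirstCountableTopology X] [FirstCountableTopology U]
    (hconv : ∀ (x : X) (u : U) (xn : ℕ → X) (un : ℕ → U),
      Tendsto xn atTop (𝓝 x) → Tendsto un atTop (𝓝 u) →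
        Tendsto (fun n => kernelProb (Tn n) (xn n, un n)) atTop (𝓝 (kernelProb T (x, u)))) :
    KernelsConvergeContinuously atTop Tn T := by
  rintro ⟨x, u⟩
  refine tendsto_of_subseq_tendsto fun ns hns => ?_
  have hns1 : Tendsto (fun k => (ns k).1) atTop atTop := tendsto_fst.comp hns
  have hns2 : Tendsto (fun k => (ns k).2) atTop (𝓝 (x, u)) := tendsto_snd.comp hns
  obtain ⟨φ, hφ, hφ'⟩ := strictMono_subseq_of_tendsto_atTop hns1
  refine ⟨φ, ?_⟩
  set N : ℕ → ℕ := fun k => (ns (φ k)).1 with hN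
  have hNmono : StrictMono N := hφ'
  set p : ℕ → X × U := Function.extend N (fun k => (ns (φ k)).2) (fun _ => (x, u)) with hp
  -- The hypothesis concerns sequences with one point per index, so the gaps between the indices `N
  -- k` are filled with the limit point.
  have hpN : ∀ k, p (N k) = (ns (φ k)).2 := fun k => hNmono.injective.extend_apply _ _ k
  have hplim : Tendsto p atTop (𝓝 (x, u)) := by
    intro W hW
    have h1 := hφ.tendsto_atTop.eventually (hns2.eventually hW)
    obtain ⟨k0, hk0⟩ := eventually_atTop.mp h1
    refine mem_map.mpr (mem_atTop_sets.mpr ⟨N k0, fun n hn => ?_⟩)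
    by_cases h : ∃ k, N k = n
    · obtain ⟨k, rfl⟩ := h
      simp only [Set.mem_preimage, hpN]
      exact hk0 k (hNmono.le_iff_le.mp hn)
    · simp only [Set.mem_preimage, hp, Function.extend_apply' _ _ _ h]
      exact mem_of_mem_nhds hW
  have h := hconv x u (fun n => (p n).1) (fun n => (p n).2)
    ((continuous_fst.tendsto _).comp hplim) ((continuous_snd.tendsto _).comp hplim)
  refine (h.comp hNmono.tendsto_atTop).congr fun k => ?_
  simp only [Function.comp_apply, Prod.mk.eta, hpN]
  rfl

/-- Asymptotic upper bounds pass through the kernels, uniformly in the action. -/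
lemma KernelsConvergeContinuously.eventually_forall_integral_lt [CompactSpace U]
    (hT : KernelsConvergeContinuously L Tn T) {f : ℕ → X → ℝ} {K a : ℝ}
    (hf : ∀ n, BddMeasurable K (f n)) (ha : IsAsympUpperBound L f a) (x : X) {ε : ℝ}
    (hε : 0 < ε) :
    ∀ᶠ p : ℕ × X in L ×ˢ 𝓝 x, ∀ u : U, ∫ y, f p.1 y ∂(Tn p.1 (p.2, u)) < a + ε :=
  eventually_forall_of_compactSpace fun u =>
    IsAsympUpperBound.eventually_integral_lt tendsto_fst (hT (x, u)) hf ha hε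

/-- Uniformity in the action is what lets `γ n` be discontinuous and vary with `n`. -/
lemma IsAsympUpperBound.policyAvg [CompactSpace U]
    (hT : KernelsConvergeContinuously L Tn T) (γ : ℕ → StationaryPolicy X U)
    {f : ℕ → X → ℝ} {K a : ℝ} (hf : ∀ n, BddMeasurable K (f n)) (ha : IsAsympUpperBound L f a) :
    IsAsympUpperBound L (fun n => _root_.policyAvg (Tn n) (γ n) (f n)) a := fun x ε hε => by
  filter_upwards [hT.eventually_forall_integral_lt hf ha x hε] with p hp
  exact hp _

lemma IsAsympUpperBound.policyAvg_iterate [CompactSpace U]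
    (hT : KernelsConvergeContinuously L Tn T) (γ : ℕ → StationaryPolicy X U)
    {f : ℕ → X → ℝ} {K a : ℝ} (hf : ∀ n, BddMeasurable K (f n)) (ha : IsAsympUpperBound L f a)
    (k : ℕ) :
    IsAsympUpperBound L (fun n => (_root_.policyAvg (Tn n) (γ n))^[k] (f n)) a := by
  induction k with
  | zero => simpa using ha
  | succ k ih =>
    simp only [Function.iterate_succ_apply']
    exact ih.policyAvg hT γ fun n => (hf n).policyAvg_iterate _ _ _

omit [SecondCountableTopology X] [HasOuterApproxClosed X] in
/-- Integrals of one continuous function against `Tn n` and `T` merge, uniformly in the action. -/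
lemma KernelsConvergeContinuously.eventually_forall_abs_sub_lt [CompactSpace U]
    (hT : KernelsConvergeContinuously L Tn T) (hT' : Continuous (kernelProb T))
    (h : BoundedContinuousFunction X ℝ) (x : X) {ε : ℝ} (hε : 0 < ε) :
    ∀ᶠ p : ℕ × X in L ×ˢ 𝓝 x, ∀ u : U,
      |∫ y, h y ∂(Tn p.1 (p.2, u)) - ∫ y, h y ∂(T (p.2, u))| < ε := by
  refine eventually_forall_of_compactSpace fun u => ?_
  have h1 := ProbabilityMeasure.tendsto_iff_forall_integral_tendsto.mp (hT (x, u)) h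
  have h2 := ProbabilityMeasure.tendsto_iff_forall_integral_tendsto.mp
    (kernelsConvergeContinuously_const (L := L) hT' (x, u)) h
  have h3 := (h1.sub h2).abs
  rw [sub_self, abs_zero] at h3
  exact h3.eventually_lt_const hε

end Weak

/-! ### Measurable near-minimizers -/

section Selection

variable {X U : Type*} [MeasurableSpace X] [MeasurableSpace U] [TopologicalSpace X]
  [TopologicalSpace U] [CompactSpace U]

omit [MeasurableSpace X] [MeasurableSpace U] in
lemma bddBelow_range_section {F : X × U → ℝ} (hF : Continuous F) (x : X) :
    BddBelow (Set.range fun u => F (x, u)) :=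
  (isCompact_range (by fun_prop)).bddBelow

omit [MeasurableSpace X] [MeasurableSpace U] in
lemma continuous_iInf_section {F : X × U → ℝ} (hF : Continuous F) :
    Continuous fun x => ⨅ u, F (x, u) := by
  have := (isCompact_univ (X := U)).continuous_sInf (f := fun x u => F (x, u)) hF
  simpa [sInf_image', iInf, Set.image_univ] using this

/-- Nearly minimal actions can be chosen measurably. -/
lemma exists_policy_lt_iInf_add [OpensMeasurableSpace X] [SecondCountableTopology U] [Nonempty U]
    {F : X × U → ℝ} (hF : Continuous F) {ε : ℝ} (hε : 0 < ε) :
    ∃ γ : StationaryPolicy X U, ∀ x, F (x, γ.act x) < (⨅ u, F (x, u)) + ε := by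
  classical
  -- The slack `ε` makes the condition open in the action, so a dense sequence meets it; taking the
  -- first good index is measurable.
  have hex : ∀ x, ∃ i, F (x, TopologicalSpace.denseSeq U i) < (⨅ u, F (x, u)) + ε := by
    intro x
    obtain ⟨u, hu⟩ := exists_lt_of_ciInf_lt (f := fun u => F (x, u))
      (show (⨅ u, F (x, u)) < (⨅ u, F (x, u)) + ε by linarith)
    have hop : IsOpen {u | F (x, u) < (⨅ u, F (x, u)) + ε} :=
      isOpen_lt (by fun_prop) continuous_const
    obtain ⟨_, hv, i, rfl⟩ := (TopologicalSpace.denseRange_denseSeq U).inter_open_nonempty _ hop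
      ⟨u, hu⟩
    exact ⟨i, hv⟩
  have hmeas : ∀ i, MeasurableSet
      {x | F (x, TopologicalSpace.denseSeq U i) < (⨅ u, F (x, u)) + ε} := fun i =>
    (isOpen_lt (by fun_prop) ((continuous_iInf_section hF).add continuous_const)).measurableSet
  refine ⟨⟨fun x => TopologicalSpace.denseSeq U (Nat.find (hex x)),
    (measurable_of_countable (TopologicalSpace.denseSeq U)).comp (measurable_find hex hmeas)⟩,
    fun x => Nat.find_spec (hex x)⟩

end Selection

/-! ### Approximate optimality equation from a discounted one -/

section Discounted

variable {X U : Type*} [MeasurableSpace X] [MeasurableSpace U] [TopologicalSpace X]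
  [TopologicalSpace U] [CompactSpace U] [OpensMeasurableSpace X]

omit [CompactSpace U] in
lemma continuous_integral_kernel {T : Kernel (X × U) X} [IsMarkovKernel T]
    (hT : Continuous (kernelProb T)) (h : BoundedContinuousFunction X ℝ) :
    Continuous fun p => ∫ y, h y ∂(T p) :=
  continuous_iff_continuousAt.mpr fun p =>
    ProbabilityMeasure.tendsto_iff_forall_integral_tendsto.mp (hT.tendsto p) h

omit [TopologicalSpace U] [CompactSpace U] [MeasurableSpace U] in
lemma BoundedContinuousFunction.bddMeasurable (h : BoundedContinuousFunction X ℝ) :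
    BddMeasurable ‖h‖ h :=
  ⟨h.continuous.measurable, fun x => h.norm_coe_le_norm x⟩

/-- The discounted optimality equation has a bounded continuous solution. -/
lemma exists_discounted_fixedPoint [Nonempty U] {c : X × U → ℝ} (hc : Continuous c) {C : ℝ}
    (hcb : ∀ p, |c p| ≤ C) {T : Kernel (X × U) X} [IsMarkovKernel T]
    (hT : Continuous (kernelProb T)) {α : ℝ} (hα : 0 ≤ α) (hα1 : α < 1) :
    ∃ h : BoundedContinuousFunction X ℝ,
      ∀ x, h x = ⨅ u, (c (x, u) + α * ∫ y, h y ∂(T (x, u))) := by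
  have hF : ∀ h : BoundedContinuousFunction X ℝ,
      Continuous fun p => c p + α * ∫ y, h y ∂(T p) := fun h =>
    hc.add (continuous_const.mul (continuous_integral_kernel hT h))
  have hFb : ∀ (h : BoundedContinuousFunction X ℝ) p,
      |c p + α * ∫ y, h y ∂(T p)| ≤ C + α * ‖h‖ := by
    intro h p
    refine (abs_add_le _ _).trans (add_le_add (hcb p) ?_)
    rw [abs_mul, abs_of_nonneg hα]
    exact mul_le_mul_of_nonneg_left (h.bddMeasurable.integral_abs_le (T p)) hα
  let B : BoundedContinuousFunction X ℝ → BoundedContinuousFunction X ℝ := fun h =>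
    BoundedContinuousFunction.ofNormedAddCommGroup
      (fun x => ⨅ u, (c (x, u) + α * ∫ y, h y ∂(T (x, u)))) (continuous_iInf_section (hF h))
      (C + α * ‖h‖) fun x => by
        rw [Real.norm_eq_abs, abs_le]
        refine ⟨le_ciInf fun u => (abs_le.mp (hFb h (x, u))).1, ?_⟩
        exact (ciInf_le (bddBelow_range_section (hF h) x) (Classical.arbitrary U)).trans
          (abs_le.mp (hFb h _)).2
  have hle : ∀ h h' : BoundedContinuousFunction X ℝ, ∀ x, B h x ≤ B h' x + α * dist h h' := by
    intro h h' x
    have : B h x - α * dist h h' ≤ B h' x := by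
      refine le_ciInf fun u => ?_
      have h1 : B h x ≤ c (x, u) + α * ∫ y, h y ∂(T (x, u)) :=
        ciInf_le (bddBelow_range_section (hF h) x) u
      have h2 : ∫ y, h y ∂(T (x, u)) ≤ ∫ y, h' y ∂(T (x, u)) + dist h h' := by
        rw [← sub_le_iff_le_add', ← integral_sub (h.bddMeasurable.integrable _)
          (h'.bddMeasurable.integrable _)]
        refine (h.bddMeasurable.sub h'.bddMeasurable).integral_le _ fun y => ?_
        exact (le_abs_self _).trans (by simpa [Real.dist_eq] using h.dist_coe_le_dist (g := h') y)
      nlinarith [mul_le_mul_of_nonneg_left h2 hα]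
    linarith
  have hcontr : ContractingWith α.toNNReal B := by
    refine ⟨Real.toNNReal_lt_one.mpr hα1, LipschitzWith.of_dist_le_mul fun h h' => ?_⟩
    refine (BoundedContinuousFunction.dist_le (by positivity)).mpr fun x => ?_
    rw [Real.dist_eq, abs_le]
    have h1 := hle h h' x
    have h2 := hle h' h x
    rw [dist_comm] at h2
    rw [Real.coe_toNNReal α hα]
    constructor <;> linarith
  refine ⟨hcontr.fixedPoint, fun x => ?_⟩
  conv_lhs => rw [← hcontr.fixedPoint_isFixedPt.eq]
  rfl

/-- Under uniform ergodicity and weak continuity, the average cost optimality equation has bounded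
continuous approximate solutions, with a nearly minimizing stationary policy. -/
lemma exists_approx_ACOE [SecondCountableTopology U] [Nonempty X] [Nonempty U]
    {c : X × U → ℝ} (hc : Continuous c)
    (hcb : ∃ C, ∀ p, |c p| ≤ C) {T : Kernel (X × U) X} [IsMarkovKernel T]
    (hT : Continuous (kernelProb T)) (herg : UniformlyErgodic fun _ : Unit => T) {ε : ℝ}
    (hε : 0 < ε) :
    ∃ (j : ℝ) (h : BoundedContinuousFunction X ℝ) (g : StationaryPolicy X U),
      (∀ x u, j + h x ≤ c (x, u) + ∫ y, h y ∂(T (x, u)) + ε) ∧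
      ∀ x, c (x, g.act x) + ∫ y, h y ∂(T (x, g.act x)) ≤ j + h x + ε := by
  obtain ⟨C, hC⟩ := hcb
  obtain ⟨t, -, β, hβ, hβ1, htv⟩ := herg
  obtain ⟨x0⟩ := id ‹Nonempty X›
  obtain ⟨u0⟩ := id ‹Nonempty U›
  have hC0 : 0 ≤ C := (abs_nonneg _).trans (hC (x0, u0))
  -- The forcing term of `g` is the cost up to the selection slack `ζ ≤ 1`, hence `C + 1`. As `Ω`
  -- does not involve the discount, `κ` can be chosen after it.
  set Ω := 2 * t * (C + 1) / (1 - β) with hΩ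
  have hΩ0 : 0 ≤ Ω := div_nonneg (by positivity) (by linarith)
  set κ := min 1 (ε / 2 / (Ω + 1)) with hκ
  have hκpos : 0 < κ := lt_min one_pos (by positivity)
  have hκ1 : κ ≤ 1 := min_le_left _ _
  have hκΩ : κ * Ω ≤ ε / 2 := by
    have h1 : κ * (Ω + 1) ≤ ε / 2 := (le_div_iff₀ (by linarith)).mp (min_le_right _ _)
    nlinarith
  obtain ⟨h, hh⟩ := exists_discounted_fixedPoint hc hC hT (α := 1 - κ) (by linarith)
    (by linarith)
  have hF : Continuous fun p => c p + (1 - κ) * ∫ y, h y ∂(T p) :=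
    hc.add (continuous_const.mul (continuous_integral_kernel hT h))
  set ζ := min 1 (ε / 2) with hζ
  obtain ⟨g, hg⟩ := exists_policy_lt_iInf_add hF (ε := ζ) (lt_min one_pos (by linarith))
  have hζ1 : ζ ≤ 1 := min_le_left _ _
  have hζε : ζ ≤ ε / 2 := min_le_right _ _
  have hle : ∀ x u, h x ≤ c (x, u) + (1 - κ) * ∫ y, h y ∂(T (x, u)) := fun x u => by
    rw [hh x]; exact ciInf_le (bddBelow_range_section hF x) u
  have hge : ∀ x, c (x, g.act x) + (1 - κ) * ∫ y, h y ∂(T (x, g.act x)) ≤ h x + ζ := fun x => by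
    conv_rhs => rw [hh x]
    exact (hg x).le
  have hosc : ∀ x x', |h x - h x'| ≤ Ω := by
    refine osc_le_of_poisson T g hβ1 (htv () g) (α := 1 - κ) (m := 0)
      (q := fun x => h x - (1 - κ) * policyAvg T g h x)
      (by linarith) (by linarith) h.bddMeasurable (fun x => ?_) (fun x => by ring)
    have h1 := hle x (g.act x)
    have h2 := hge x
    have h3 := abs_le.mp (hC (x, g.act x))
    rw [abs_le]
    simp only [policyAvg]
    constructor <;> linarith
  have hint1 : ∀ p, ∫ y, h y ∂(T p) ≤ h x0 + Ω := fun p =>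
    h.bddMeasurable.integral_le _ fun y => by linarith [(abs_le.mp (hosc y x0)).2]
  have hint2 : ∀ p, h x0 - Ω ≤ ∫ y, h y ∂(T p) := fun p =>
    h.bddMeasurable.le_integral _ fun y => by linarith [(abs_le.mp (hosc y x0)).1]
  -- Removing the discount leaves `κ` times an average of `h`, within `κ * Ω ≤ ε / 2` of `κ * h x0`.
  refine ⟨κ * h x0, h, g, fun x u => ?_, fun x => ?_⟩
  · have h1 := mul_le_mul_of_nonneg_left (hint2 (x, u)) hκpos.le
    linarith [hle x u]
  · have h1 := mul_le_mul_of_nonneg_left (hint1 (x, g.act x)) hκpos.le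
    linarith [hge x]

end Discounted

/-! ### Least asymptotic upper bounds along an ultrafilter -/

section Best

variable {X : Type*} [TopologicalSpace X] {L : Filter ℕ} [L.NeBot] {f g : ℕ → X → ℝ}

/-- The least asymptotic upper bound. -/
noncomputable def asympSup (L : Filter ℕ) (f : ℕ → X → ℝ) : ℝ :=
  sInf {b | IsAsympUpperBound L f b}

lemma IsAsympUpperBound.le_of_forall_ge [Nonempty X] {a b : ℝ} (hf : IsAsympUpperBound L f b)
    (h : ∀ n x, a ≤ f n x) : a ≤ b := by
  obtain ⟨x⟩ := id ‹Nonempty X›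
  refine le_of_forall_pos_lt_add fun ε hε => ?_
  obtain ⟨n, hn⟩ := (hf.eventually_lt x hε).exists
  exact (h n x).trans_lt hn

lemma asympSup_le [Nonempty X] {K b : ℝ} (hK : ∀ n x, |f n x| ≤ K)
    (hf : IsAsympUpperBound L f b) : asympSup L f ≤ b :=
  csInf_le ⟨-K, fun _ hb => hb.le_of_forall_ge fun n x => (abs_le.mp (hK n x)).1⟩ hf

omit [L.NeBot] in
lemma isAsympUpperBound_asympSup {K : ℝ} (hK : ∀ n x, |f n x| ≤ K) :
    IsAsympUpperBound L f (asympSup L f) := by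
  refine IsAsympUpperBound.of_forall_pos fun δ hδ => ?_
  obtain ⟨b, hb, hlt⟩ := exists_lt_of_csInf_lt (s := {b | IsAsympUpperBound L f b})
    ⟨K, IsAsympUpperBound.of_forall_le fun n x => (abs_le.mp (hK n x)).2⟩
    (show sInf _ < asympSup L f + δ by simpa [asympSup] using hδ)
  exact IsAsympUpperBound.mono hb (fun _ _ => le_rfl) hlt.le

/-- Along an ultrafilter the least asymptotic upper bound is nearly attained near some state, for
almost all indices. -/
lemma exists_state_eventually_exists_gt [Nonempty X] {L : Ultrafilter ℕ} {K : ℝ}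
    (hK : ∀ n x, |f n x| ≤ K) {δ : ℝ} (hδ : 0 < δ) :
    ∃ x : X, ∀ V ∈ 𝓝 x, ∀ᶠ n in (L : Filter ℕ), ∃ y ∈ V, asympSup L f - δ < f n y := by
  -- For an ultrafilter, failing to hold eventually means eventually failing.
  by_contra! hcon
  have : IsAsympUpperBound (L : Filter ℕ) f (asympSup L f - δ) := by
    intro x ε hε
    obtain ⟨V, hV, hnot⟩ := hcon x
    filter_upwards [prod_mem_prod hnot hV] with p hp
    have h1 := hp.1 p.2 hp.2
    linarith
  linarith [asympSup_le hK this]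

end Best

/-! ### The comparison principle -/

section Drift

variable {X U : Type*} [MeasurableSpace X] [MeasurableSpace U] [TopologicalSpace X]
  [TopologicalSpace U] [BorelSpace X] [SecondCountableTopology X] [HasOuterApproxClosed X]
  [CompactSpace U]
  {Tn : ℕ → Kernel (X × U) X} [∀ n, IsMarkovKernel (Tn n)]
  {T : Kernel (X × U) X} [IsMarkovKernel T]

/-- If `ψ n` is asymptotically valued in `[-R, R]` and drifts up by at least `-η` where positive,
then `k` steps of the chain cannot push it far down from values close to `R`. -/
lemma isAsympUpperBound_persistence {L : Filter ℕ} (hT : KernelsConvergeContinuously L Tn T)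
    (γ : ℕ → StationaryPolicy X U) {ψ : ℕ → X → ℝ} {K R η : ℝ} (hR : 0 ≤ R) (hη : 0 ≤ η)
    (hψ : ∀ n, BddMeasurable K (ψ n)) (hup : IsAsympUpperBound L ψ R)
    (hlow : IsAsympUpperBound L (fun n x => -ψ n x) R)
    (hdrift : ∀ x, ∀ δ > 0, ∀ᶠ p : ℕ × X in L ×ˢ 𝓝 x, 0 < ψ p.1 p.2 →
      ψ p.1 p.2 - policyAvg (Tn p.1) (γ p.1) (ψ p.1) p.2 < η + δ) (k : ℕ) :
    IsAsympUpperBound L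
      (fun n x => R - 2 ^ (k + 1) * (R - ψ n x) - (policyAvg (Tn n) (γ n))^[k] (ψ n) x)
      (2 ^ (k + 1) * η) := by
  induction k with
  | zero =>
    intro x ε hε
    filter_upwards [hup x ε hε] with p hp
    simp only [zero_add, pow_one, Function.iterate_zero, id_eq]
    linarith
  | succ k ih =>
    set E : ℝ := 2 ^ (k + 1) with hE
    have hE1 : 1 ≤ E := one_le_pow₀ (by norm_num)
    have hE2 : (2 : ℝ) ^ (k + 1 + 1) = 2 * E := by rw [hE, pow_succ]; ring
    have hb1 : ∀ n, BddMeasurable (|R - E * R| + |E| * K) (fun x => (R - E * R) + E * ψ n x) :=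
      fun n => (BddMeasurable.const _).add ((hψ n).const_mul E)
    have hfun : ∀ n, (fun x => R - E * (R - ψ n x) - (policyAvg (Tn n) (γ n))^[k] (ψ n) x) =
        fun x => ((R - E * R) + E * ψ n x) - (policyAvg (Tn n) (γ n))^[k] (ψ n) x := fun n =>
      funext fun x => by ring
    have hA := ih.policyAvg hT γ (K := |R - E * R| + |E| * K + K) fun n => by
      rw [hfun n]; exact (hb1 n).sub ((hψ n).policyAvg_iterate _ _ k)
    have hA' : ∀ n x, policyAvg (Tn n) (γ n)
        (fun x => R - E * (R - ψ n x) - (policyAvg (Tn n) (γ n))^[k] (ψ n) x) x =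
        (R - E * R) + E * policyAvg (Tn n) (γ n) (ψ n) x -
          (policyAvg (Tn n) (γ n))^[k + 1] (ψ n) x := by
      intro n x
      rw [hfun n, policyAvg_sub _ _ (hb1 n) ((hψ n).policyAvg_iterate _ _ k),
        policyAvg_add _ _ (BddMeasurable.const _) ((hψ n).const_mul E), policyAvg_const,
        policyAvg_const_mul, Function.iterate_succ_apply']
    have hlow' := IsAsympUpperBound.policyAvg_iterate hT γ (fun n => (hψ n).neg) hlow (k + 1)
    simp only [policyAvg_iterate_neg] at hlow'
    intro x ε hε
    have hε' : 0 < ε / (3 * E) := by positivity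
    filter_upwards [hA x (ε / 3) (by linarith), hlow' x ε hε, hup x _ hε', hdrift x _ hε']
      with p h1 h2 h3 h4
    rw [hA' p.1 p.2] at h1
    rw [hE2]
    have hEε : E * (ε / (3 * E)) = ε / 3 := by field_simp
    -- Where `ψ ≤ 0` the doubled factor makes the claim trivial: `R - 2 * E * (R - ψ)` is at most
    -- `-R`. Elsewhere the drift bound applies, and the doubling absorbs its error `E * η`.
    rcases le_or_gt (ψ p.1 p.2) 0 with hneg | hpos
    · nlinarith
    · have h5 := mul_lt_mul_of_pos_left (h4 hpos) (by linarith : 0 < E)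
      have h6 := mul_lt_mul_of_pos_left h3 (by linarith : 0 < E)
      nlinarith

/-- The part of `ψ n` outside its asymptotic range is invisible after finitely many steps. -/
lemma isAsympUpperBound_sub_clamp {L : Filter ℕ} (hT : KernelsConvergeContinuously L Tn T)
    (γ : ℕ → StationaryPolicy X U) {ψ : ℕ → X → ℝ} {K R : ℝ} (hR : 0 ≤ R)
    (hψ : ∀ n, BddMeasurable K (ψ n)) (hup : IsAsympUpperBound L ψ R) (k : ℕ) :
    IsAsympUpperBound L (fun n x => (policyAvg (Tn n) (γ n))^[k] (ψ n) x -
      (policyAvg (Tn n) (γ n))^[k] (fun y => max (-R) (min R (ψ n y))) x) 0 := by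
  have hclamp : ∀ n, BddMeasurable R (fun y => max (-R) (min R (ψ n y))) := fun n =>
    ⟨measurable_const.max (measurable_const.min (hψ n).measurable), fun y =>
      abs_le.mpr ⟨le_max_left _ _, max_le (by linarith) (min_le_left _ _)⟩⟩
  have h0 : IsAsympUpperBound L (fun n y => ψ n y - max (-R) (min R (ψ n y))) 0 := by
    intro x ε hε
    filter_upwards [hup x ε hε] with p hp
    rcases le_total R (ψ p.1 p.2) with h | h
    · rw [min_eq_left h, max_eq_right (by linarith)]; linarith
    · rw [min_eq_right h]; linarith [le_max_right (-R) (ψ p.1 p.2)]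
  have := IsAsympUpperBound.policyAvg_iterate hT γ (fun n => (hψ n).sub (hclamp n)) h0 k
  have heq : ∀ n, (policyAvg (Tn n) (γ n))^[k] (fun y => ψ n y - max (-R) (min R (ψ n y))) =
      fun x => (policyAvg (Tn n) (γ n))^[k] (ψ n) x -
        (policyAvg (Tn n) (γ n))^[k] (fun y => max (-R) (min R (ψ n y))) x := fun n =>
    policyAvg_iterate_sub _ _ (hψ n) (hclamp n) k
  simpa only [heq] using this

/-- Comparison principle: a bounded sequence that is asymptotically a submartingale under the
policies `g n` and a supermartingale under the policies `γ n` has small asymptotic span. -/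
lemma asympSup_add_asympSup_neg_le [Nonempty X] {L : Ultrafilter ℕ}
    (hT : KernelsConvergeContinuously (L : Filter ℕ) Tn T) {t : ℕ} {β : ℝ} (hβ1 : β < 1)
    (htv : ∀ n (γ : StationaryPolicy X U) (x x' : X),
      tvDist (stepKernel (Tn n) γ t x) (stepKernel (Tn n) γ t x') ≤ 2 * β)
    (g γ : ℕ → StationaryPolicy X U) {w : ℕ → X → ℝ} {K η : ℝ} (hη : 0 ≤ η)
    (hw : ∀ n, BddMeasurable K (w n))
    (hsub : IsAsympUpperBound (L : Filter ℕ)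
      (fun n x => w n x - policyAvg (Tn n) (g n) (w n) x) η)
    (hsup : IsAsympUpperBound (L : Filter ℕ)
      (fun n x => policyAvg (Tn n) (γ n) (w n) x - w n x) η) :
    asympSup L w + asympSup L (fun n x => -w n x) ≤ 2 ^ (t + 2) * η / (1 - β) := by
  classical
  set b := asympSup (L : Filter ℕ) w with hb
  set a := asympSup (L : Filter ℕ) (fun n x => -w n x) with ha
  have hwK : ∀ n x, |w n x| ≤ K := fun n => (hw n).bound
  have hwK' : ∀ n x, |-w n x| ≤ K := fun n x => by simpa using hwK n x
  have hbu : IsAsympUpperBound (L : Filter ℕ) w b := isAsympUpperBound_asympSup hwK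
  have hau : IsAsympUpperBound (L : Filter ℕ) (fun n x => -w n x) a :=
    isAsympUpperBound_asympSup hwK'
  have hab : 0 ≤ b + a := (hbu.add hau).le_of_forall_ge fun n x => by simp
  set R := (b + a) / 2 with hR
  set m := (b - a) / 2 with hm
  have hR0 : 0 ≤ R := by linarith
  set ψ : ℕ → X → ℝ := fun n x => w n x - m with hψdef
  have hψ : ∀ n, BddMeasurable (K + |m|) (ψ n) := fun n => (hw n).sub (BddMeasurable.const m)
  have hψA : ∀ n (σ : StationaryPolicy X U) x,
      policyAvg (Tn n) σ (ψ n) x = policyAvg (Tn n) σ (w n) x - m := fun n σ x => by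
    simp only [hψdef]
    rw [policyAvg_sub _ _ (hw n) (BddMeasurable.const m), policyAvg_const]
  have hup : IsAsympUpperBound (L : Filter ℕ) ψ R := fun x ε hε => by
    filter_upwards [hbu x ε hε] with p hp
    simp only [hψdef]; linarith
  have hlow : IsAsympUpperBound (L : Filter ℕ) (fun n x => -ψ n x) R := fun x ε hε => by
    filter_upwards [hau x ε hε] with p hp
    simp only [hψdef]; linarith
  -- Follow `g n` above the middle level and `γ n` below it.
  let σ : ℕ → StationaryPolicy X U := fun n =>
    ⟨fun x => if 0 < ψ n x then (g n).act x else (γ n).act x,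
      Measurable.ite (measurableSet_lt measurable_const (hψ n).measurable)
        (g n).measurable_act (γ n).measurable_act⟩
  have hσ1 : ∀ n x, 0 < ψ n x →
      policyAvg (Tn n) (σ n) (ψ n) x = policyAvg (Tn n) (g n) (ψ n) x := fun n x h => by
    simp only [policyAvg, σ, if_pos h]
  have hσ2 : ∀ n x, 0 < -ψ n x →
      policyAvg (Tn n) (σ n) (ψ n) x = policyAvg (Tn n) (γ n) (ψ n) x := fun n x h => by
    simp only [policyAvg, σ, if_neg (show ¬ 0 < ψ n x by linarith)]
  have hpers := isAsympUpperBound_persistence hT σ hR0 hη hψ hup hlow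
    (fun x δ hδ => by
      filter_upwards [hsub x δ hδ] with p hp hpos
      rw [hσ1 _ _ hpos, hψA]; simp only [hψdef]; linarith) t
  have hpers' := isAsympUpperBound_persistence hT σ (ψ := fun n x => -ψ n x) hR0 hη
    (fun n => (hψ n).neg) hlow (by simpa using hup)
    (fun x δ hδ => by
      filter_upwards [hsup x δ hδ] with p hp hpos
      simp only [policyAvg_neg]
      rw [hσ2 _ _ hpos, hψA]; simp only [hψdef]; linarith) t
  -- The span contraction needs values exactly in `[-R, R]`, where `ψ n` lies only asymptotically.
  have hcl := isAsympUpperBound_sub_clamp hT σ hR0 hψ hup t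
  have hcl' := isAsympUpperBound_sub_clamp hT σ hR0 (fun n => (hψ n).neg) hlow t
  have hneg : ∀ n, (fun y => max (-R) (min R (-ψ n y))) =
      fun y => -max (-R) (min R (ψ n y)) := fun n => funext fun y => by
    rw [← min_neg_neg, neg_neg, ← max_neg_neg, min_max_distrib_left,
      min_eq_right (show -R ≤ R by linarith)]
  simp only [hneg, policyAvg_iterate_neg] at hcl' hpers'
  set E : ℝ := 2 ^ (t + 1) with hE
  have hE0 : 0 < E := by positivity
  have main : ∀ δ > 0, 2 * R * (1 - β) ≤ 2 * E * η + (2 * E + 4) * δ := by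
    intro δ hδ
    obtain ⟨x1, hx1⟩ := exists_state_eventually_exists_gt (L := L) hwK hδ
    obtain ⟨x2, hx2⟩ := exists_state_eventually_exists_gt (L := L) hwK' hδ
    obtain ⟨S1, hS1, V1, hV1, hSV1⟩ :=
      mem_prod_iff.mp ((hpers x1 δ hδ).and (hcl x1 δ hδ))
    obtain ⟨S2, hS2, V2, hV2, hSV2⟩ :=
      mem_prod_iff.mp ((hpers' x2 δ hδ).and (hcl' x2 δ hδ))
    have hS1' : ∀ᶠ n in (L : Filter ℕ), n ∈ S1 := hS1
    have hS2' : ∀ᶠ n in (L : Filter ℕ), n ∈ S2 := hS2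
    -- Both extremes must be nearly attained at one common index, so near-attainment for infinitely
    -- many indices would not suffice.
    obtain ⟨n, hn1, hn2, ⟨y1, hy1, hw1⟩, ⟨y2, hy2, hw2⟩⟩ :=
      (hS1'.and (hS2'.and ((hx1 V1 hV1).and (hx2 V2 hV2)))).exists
    obtain ⟨p1, q1⟩ := hSV1 (Set.mk_mem_prod hn1 hy1)
    obtain ⟨p2, q2⟩ := hSV2 (Set.mk_mem_prod hn2 hy2)
    have hc := abs_policyAvg_iterate_sub_le (Tn n) (σ n) (htv n (σ n) y1 y2) (a := -R)
      (D := 2 * R) (f := fun y => max (-R) (min R (ψ n y)))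
      (measurable_const.max (measurable_const.min (hψ n).measurable)) (by linarith)
      (fun y => ⟨le_max_left _ _, max_le (by linarith) (by linarith [min_le_left R (ψ n y)])⟩)
    have hc2 := (abs_le.mp hc).2
    simp only at p1 p2 q1 q2
    have e1 : R - ψ n y1 < δ := by simp only [hψdef]; linarith
    have e2 : R - -ψ n y2 < δ := by simp only [hψdef]; linarith
    have e1' := mul_lt_mul_of_pos_left e1 hE0
    have e2' := mul_lt_mul_of_pos_left e2 hE0
    linarith
  have hfin : 2 * R * (1 - β) ≤ 2 * E * η := by
    refine le_of_forall_pos_le_add fun ε hε => ?_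
    have h1 := main (ε / (2 * E + 4)) (by positivity)
    have h2 : (2 * E + 4) * (ε / (2 * E + 4)) = ε := by field_simp
    linarith
  rw [le_div_iff₀ (by linarith)]
  have : (2 : ℝ) ^ (t + 2) = 2 * E := by rw [hE, pow_succ 2 (t + 1)]; ring
  rw [this, show b + a = 2 * R by rw [hR]; ring]
  exact hfin

end Drift

/-! ### Costs under history-dependent policies -/

section History

variable {X U : Type*} [MeasurableSpace X] [MeasurableSpace U]

lemma measurable_finSnoc {Ω Y : Type*} [MeasurableSpace Ω] [MeasurableSpace Y] {n : ℕ}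
    {f : Ω → Fin n → Y} {g : Ω → Y} (hf : Measurable f) (hg : Measurable g) :
    Measurable fun ω => (Fin.snoc (α := fun _ => Y) (f ω) (g ω) : Fin (n + 1) → Y) := by
  refine measurable_pi_iff.mpr fun i => ?_
  induction i using Fin.lastCases with
  | last => simpa using hg
  | cast i => simpa using (measurable_pi_iff.mp hf) i

lemma AdmissiblePolicy.measurable_extend (γ : AdmissiblePolicy X U) (t : ℕ) :
    Measurable fun p : ((Fin (t + 1) → X) × (Fin t → U)) × X =>
      ((Fin.snoc (α := fun _ => X) p.1.1 p.2 : Fin (t + 1 + 1) → X),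
        (Fin.snoc (α := fun _ => U) p.1.2 (γ.act t p.1) : Fin (t + 1) → U)) :=
  (measurable_finSnoc (measurable_fst.comp measurable_fst) measurable_snd).prodMk
    (measurable_finSnoc (measurable_snd.comp measurable_fst)
      ((γ.measurable_act t).comp measurable_fst))

variable (T : Kernel (X × U) X) [IsMarkovKernel T] (γ : AdmissiblePolicy X U) (x : X)

instance historyLaw_isProbabilityMeasure (t : ℕ) : IsProbabilityMeasure (historyLaw T γ x t) := by
  induction t with
  | zero => rw [historyLaw]; infer_instance
  | succ t ih =>
    rw [historyLaw]
    exact Measure.isProbabilityMeasure_map (γ.measurable_extend t).aemeasurable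

lemma integral_historyLaw_succ (t : ℕ) {K : ℝ}
    {F : (Fin (t + 1 + 1) → X) × (Fin (t + 1) → U) → ℝ} (hF : BddMeasurable K F) :
    ∫ h, F h ∂(historyLaw T γ x (t + 1)) =
      ∫ h, ∫ y, F (Fin.snoc (α := fun _ => X) h.1 y, Fin.snoc (α := fun _ => U) h.2 (γ.act t h))
        ∂(T (h.1 (Fin.last t), γ.act t h)) ∂(historyLaw T γ x t) := by
  rw [historyLaw, integral_map (γ.measurable_extend t).aemeasurable
    hF.measurable.aestronglyMeasurable]
  have hG : BddMeasurable K fun p : ((Fin (t + 1) → X) × (Fin t → U)) × X =>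
      F ((Fin.snoc (α := fun _ => X) p.1.1 p.2 : Fin (t + 1 + 1) → X),
        (Fin.snoc (α := fun _ => U) p.1.2 (γ.act t p.1) : Fin (t + 1) → U)) :=
    ⟨hF.measurable.comp (γ.measurable_extend t), fun p => hF.bound _⟩
  rw [Measure.integral_compProd (hG.integrable _)]
  rfl

omit [MeasurableSpace U] in
lemma BddMeasurable.comp_state {K : ℝ} {f : X → ℝ} (hf : BddMeasurable K f) [MeasurableSpace U]
    (t : ℕ) :
    BddMeasurable K fun h : (Fin (t + 1) → X) × (Fin t → U) => f (h.1 (Fin.last t)) :=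
  ⟨hf.measurable.comp ((measurable_pi_apply _).comp measurable_fst), fun _ => hf.bound _⟩

/-- The expectation of a function of the next state. -/
lemma integral_state_succ {K : ℝ} {f : X → ℝ} (hf : BddMeasurable K f) (t : ℕ) :
    ∫ h, f (h.1 (Fin.last (t + 1))) ∂(historyLaw T γ x (t + 1)) =
      ∫ h, ∫ y, f y ∂(T (h.1 (Fin.last t), γ.act t h)) ∂(historyLaw T γ x t) := by
  rw [integral_historyLaw_succ T γ x t (hf.comp_state (t + 1))]
  simp

omit [IsMarkovKernel T] in
lemma integral_state_zero {K : ℝ} {f : X → ℝ} (hf : BddMeasurable K f) :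
    ∫ h, f (h.1 (Fin.last 0)) ∂(historyLaw T γ x 0) = f x := by
  rw [historyLaw, integral_dirac' _ _ (hf.comp_state 0).measurable.stronglyMeasurable]

/-- Under a stationary policy the state process is the closed-loop Markov chain. -/
lemma integral_state_toAdmissible (σ : StationaryPolicy X U) {K : ℝ} {f : X → ℝ}
    (hf : BddMeasurable K f) (t : ℕ) :
    ∫ h, f (h.1 (Fin.last t)) ∂(historyLaw T σ.toAdmissible x t) = (policyAvg T σ)^[t] f x := by
  induction t generalizing f with
  | zero => exact integral_state_zero T _ x hf
  | succ t ih =>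
    rw [integral_state_succ T _ x hf, Function.iterate_succ_apply, ← ih (hf.policyAvg T σ)]
    rfl

variable {c : X × U → ℝ} {C : ℝ}

lemma bddMeasurable_sum_cost (hc : BddMeasurable C c) (N : ℕ) :
    BddMeasurable (N * C) fun h : (Fin (N + 1) → X) × (Fin N → U) =>
      ∑ t : Fin N, c (h.1 t.castSucc, h.2 t) := by
  refine ⟨Finset.measurable_sum _ fun t _ => hc.measurable.comp
    (((measurable_pi_apply _).comp measurable_fst).prodMk
      ((measurable_pi_apply _).comp measurable_snd)), fun h => ?_⟩
  refine (Finset.abs_sum_le_sum_abs _ _).trans ?_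
  simpa using Finset.sum_le_sum (s := Finset.univ)
    fun (t : Fin N) _ => hc.bound (h.1 t.castSucc, h.2 t)

lemma abs_expectedCost_le (hc : BddMeasurable C c) (N : ℕ) :
    |expectedCost c T γ x N| ≤ N * C :=
  (bddMeasurable_sum_cost hc N).integral_abs_le _

omit [IsMarkovKernel T] in
lemma expectedCost_zero : expectedCost c T γ x 0 = 0 := by
  simp [expectedCost]

lemma bddMeasurable_stage (hc : BddMeasurable C c) (t : ℕ) :
    BddMeasurable C fun h : (Fin (t + 1) → X) × (Fin t → U) =>
      c (h.1 (Fin.last t), γ.act t h) :=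
  ⟨hc.measurable.comp (γ.measurable_stateAction t), fun _ => hc.bound _⟩

lemma expectedCost_succ (hc : BddMeasurable C c) (N : ℕ) :
    expectedCost c T γ x (N + 1) = expectedCost c T γ x N +
      ∫ h, c (h.1 (Fin.last N), γ.act N h) ∂(historyLaw T γ x N) := by
  rw [expectedCost, integral_historyLaw_succ T γ x N (bddMeasurable_sum_cost hc (N + 1)),
    expectedCost, ← integral_add ((bddMeasurable_sum_cost hc N).integrable _)
      ((bddMeasurable_stage γ hc N).integrable _)]
  congr 1
  funext h
  simp only [Fin.sum_univ_castSucc, Fin.snoc_castSucc, Fin.snoc_last]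
  simp

lemma abs_inv_mul_expectedCost_le (hc : BddMeasurable C c) (N : ℕ) :
    |(1 / (N : ℝ)) * expectedCost c T γ x N| ≤ C := by
  have hC : 0 ≤ C := by
    have := (abs_nonneg _).trans (abs_expectedCost_le T γ x hc 1)
    simpa using this
  rcases Nat.eq_zero_or_pos N with rfl | hN
  · simpa using hC
  · have hN' : (0 : ℝ) < N := by exact_mod_cast hN
    rw [abs_mul, abs_of_pos (by positivity), one_div, inv_mul_le_iff₀ hN']
    exact abs_expectedCost_le T γ x hc N

/-- A bounded error vanishes after division by `N`; boundedness of the averages keeps the real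
`limsup` from being a default value. -/
lemma le_averageCost_of_forall_le (hc : BddMeasurable C c) {r M : ℝ}
    (h : ∀ N : ℕ, N * r - M ≤ expectedCost c T γ x N) : r ≤ averageCost c T γ x := by
  have hlim : Tendsto (fun N : ℕ => r - M / N) atTop (𝓝 r) := by
    simpa using tendsto_const_nhds.sub (tendsto_const_div_atTop_nhds_zero_nat M)
  rw [← hlim.limsup_eq]
  refine limsup_le_limsup ?_ hlim.isCoboundedUnder_le
    ⟨C, eventually_map.mpr (Eventually.of_forall fun N =>
      (abs_le.mp (abs_inv_mul_expectedCost_le T γ x hc N)).2)⟩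
  filter_upwards [eventually_gt_atTop 0] with N hN
  have hN' : (0 : ℝ) < N := by exact_mod_cast hN
  have := mul_le_mul_of_nonneg_left (h N) (by positivity : 0 ≤ 1 / (N : ℝ))
  calc r - M / N = 1 / (N : ℝ) * (N * r - M) := by field_simp
    _ ≤ _ := this

lemma averageCost_le_of_forall_le (hc : BddMeasurable C c) {r M : ℝ}
    (h : ∀ N : ℕ, expectedCost c T γ x N ≤ N * r + M) : averageCost c T γ x ≤ r := by
  have hlim : Tendsto (fun N : ℕ => r + M / N) atTop (𝓝 r) := by
    simpa using tendsto_const_nhds.add (tendsto_const_div_atTop_nhds_zero_nat M)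
  rw [← hlim.limsup_eq]
  refine limsup_le_limsup ?_ (IsBoundedUnder.isCoboundedUnder_le
    ⟨-C, eventually_map.mpr (Eventually.of_forall fun N =>
      (abs_le.mp (abs_inv_mul_expectedCost_le T γ x hc N)).1)⟩) hlim.isBoundedUnder_le
  filter_upwards [eventually_gt_atTop 0] with N hN
  have hN' : (0 : ℝ) < N := by exact_mod_cast hN
  have := mul_le_mul_of_nonneg_left (h N) (by positivity : 0 ≤ 1 / (N : ℝ))
  calc _ ≤ 1 / (N : ℝ) * (N * r + M) := this
    _ = r + M / N := by field_simp

/-- A subsolution of the optimality equation bounds the average cost of every policy from below. -/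
lemma le_averageCost_of_subsolution (hc : BddMeasurable C c) {h : X → ℝ} {K r : ℝ}
    (hh : BddMeasurable K h) (hsub : ∀ x u, r + h x ≤ c (x, u) + ∫ y, h y ∂(T (x, u))) :
    r ≤ averageCost c T γ x := by
  have key : ∀ N : ℕ, N * r + h x ≤ expectedCost c T γ x N +
      ∫ ω, h (ω.1 (Fin.last N)) ∂(historyLaw T γ x N) := by
    intro N
    induction N with
    | zero => rw [expectedCost_zero, integral_state_zero T γ x hh]; simp
    | succ N ih =>
      have hs := bddMeasurable_stage γ hc N
      have hk : BddMeasurable K fun ω : (Fin (N + 1) → X) × (Fin N → U) =>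
          ∫ y, h y ∂(T (ω.1 (Fin.last N), γ.act N ω)) :=
        ⟨(hh.integral_kernel T).measurable.comp (γ.measurable_stateAction N),
          fun _ => hh.integral_abs_le _⟩
      rw [expectedCost_succ T γ x hc, integral_state_succ T γ x hh, add_assoc,
        ← integral_add (hs.integrable _) (hk.integrable _)]
      have h1 : r + ∫ ω, h (ω.1 (Fin.last N)) ∂(historyLaw T γ x N) ≤
          ∫ ω, (c (ω.1 (Fin.last N), γ.act N ω) +
            ∫ y, h y ∂(T (ω.1 (Fin.last N), γ.act N ω))) ∂(historyLaw T γ x N) := by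
        have h2 := integral_mono (μ := historyLaw T γ x N)
          (((BddMeasurable.const r).add (hh.comp_state N)).integrable _)
          ((hs.add hk).integrable _) fun ω => hsub _ (γ.act N ω)
        rw [integral_add (integrable_const _) ((hh.comp_state N).integrable _)] at h2
        simpa using h2
      push_cast
      linarith
  refine le_averageCost_of_forall_le T γ x hc (M := 2 * K) fun N => ?_
  have h1 := key N
  have h2 := (abs_le.mp (hh.bound x)).1
  have h3 := (abs_le.mp ((hh.comp_state (U := U) N).integral_abs_le (historyLaw T γ x N))).2
  linarith

/-- The average cost of a stationary policy in terms of the expected defect in the optimality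
equation at late times. -/
lemma averageCost_le_of_defect (σ : StationaryPolicy X U) (hc : BddMeasurable C c) {h : X → ℝ}
    {K r ε : ℝ} (hh : BddMeasurable K h) (N0 : ℕ)
    (hdef : ∀ N ≥ N0, (policyAvg T σ)^[N]
      (fun y => c (y, σ.act y) + policyAvg T σ h y - r - h y) x ≤ ε) :
    averageCost c T σ.toAdmissible x ≤ r + ε := by
  set γ := σ.toAdmissible with hγ
  set D : X → ℝ := fun y => c (y, σ.act y) + policyAvg T σ h y - r - h y with hD
  have hcσ : BddMeasurable C fun y => c (y, σ.act y) :=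
    ⟨hc.measurable.comp (measurable_id.prodMk σ.measurable_act), fun _ => hc.bound _⟩
  have hDb : BddMeasurable (C + K + |r| + K) D :=
    ((hcσ.add (hh.policyAvg T σ)).sub (BddMeasurable.const r)).sub hh
  set M := C + K + |r| + K with hM
  have hM0 : 0 ≤ M := (abs_nonneg _).trans (hDb.bound x)
  have hstep : ∀ N, (policyAvg T σ)^[N] D x = ∫ ω, c (ω.1 (Fin.last N), γ.act N ω)
      ∂(historyLaw T γ x N) + ∫ ω, h (ω.1 (Fin.last (N + 1))) ∂(historyLaw T γ x (N + 1)) - r -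
      ∫ ω, h (ω.1 (Fin.last N)) ∂(historyLaw T γ x N) := by
    intro N
    rw [← integral_state_toAdmissible T x σ hDb, integral_state_succ T _ x hh]
    have b1 := hcσ.comp_state (U := U) N
    have b2 := (hh.policyAvg T σ).comp_state (U := U) N
    have b3 := hh.comp_state (U := U) N
    have b12 := b1.add b2
    have b4 := b12.sub (BddMeasurable.const r)
    simp only [hD]
    rw [integral_sub (b4.integrable _) (b3.integrable _),
      integral_sub (b12.integrable _) (integrable_const r),
      integral_add (b1.integrable _) (b2.integrable _)]
    simp only [integral_const, probReal_univ, one_smul]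
    rfl
  have key : ∀ N : ℕ, expectedCost c T γ x N +
      ∫ ω, h (ω.1 (Fin.last N)) ∂(historyLaw T γ x N) ≤ N * (r + ε) + N0 * (M + |ε|) + h x := by
    intro N
    have hsum : ∀ N : ℕ, expectedCost c T γ x N + ∫ ω, h (ω.1 (Fin.last N))
        ∂(historyLaw T γ x N) = N * r + h x + ∑ i ∈ Finset.range N, (policyAvg T σ)^[i] D x := by
      intro N
      induction N with
      | zero => rw [expectedCost_zero, integral_state_zero T γ x hh]; simp
      | succ N ih =>
        rw [expectedCost_succ T γ x hc, Finset.sum_range_succ, hstep N]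
        push_cast
        linarith
    -- Stages before `N0` have only the crude bound `M`; their total excess does not grow with `N`.
    have hle : ∀ N : ℕ, ∑ i ∈ Finset.range N, (policyAvg T σ)^[i] D x ≤
        N * ε + (min N N0 : ℕ) * (M + |ε|) := by
      intro N
      induction N with
      | zero => simp
      | succ N ih =>
        rw [Finset.sum_range_succ]
        rcases le_or_gt N0 N with hN | hN
        · rw [min_eq_right hN] at ih
          rw [min_eq_right (by omega)]
          push_cast
          linarith [hdef N hN]
        · rw [min_eq_left hN.le] at ih
          rw [min_eq_left (by omega)]
          have h1 := (abs_le.mp ((hDb.policyAvg_iterate T σ N).bound x)).2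
          have h2 := neg_abs_le ε
          push_cast
          linarith
    have h1 : ((min N N0 : ℕ) : ℝ) * (M + |ε|) ≤ N0 * (M + |ε|) := by
      refine mul_le_mul_of_nonneg_right ?_ (by positivity)
      exact_mod_cast min_le_right N N0
    rw [hsum N]
    linarith [hle N]
  refine averageCost_le_of_forall_le T γ x hc (M := N0 * (M + |ε|) + 2 * K) fun N => ?_
  have h1 := key N
  have h2 := (abs_le.mp (hh.bound x)).2
  have h3 := (abs_le.mp ((hh.comp_state (U := U) N).integral_abs_le (historyLaw T γ x N))).1
  linarith

end History

/-! ### Near-optimality along an ultrafilter and the conclusion -/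

section Main

variable {X U : Type*} [MeasurableSpace X] [MeasurableSpace U]

lemma policyAvg_iterate_le (T : Kernel (X × U) X) [IsMarkovKernel T] (γ : StationaryPolicy X U)
    {K a : ℝ} {f : X → ℝ} (hf : BddMeasurable K f) (h : ∀ x, f x ≤ a) (k : ℕ) (x : X) :
    (policyAvg T γ)^[k] f x ≤ a := by
  rw [← integral_stepKernel T γ hf]
  exact hf.integral_le _ h

/-- A solution of the optimality equation, normalized at a state, is bounded in terms of the rate of
ergodicity. -/
lemma SatisfiesACOE.exists_normalized {c : X × U → ℝ} {C : ℝ} (hc : BddMeasurable C c)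
    {T : Kernel (X × U) X} [IsMarkovKernel T] {γ : StationaryPolicy X U}
    (h : SatisfiesACOE c T γ) {t : ℕ} {β : ℝ} (hβ1 : β < 1)
    (htv : ∀ x x', tvDist (stepKernel T γ t x) (stepKernel T γ t x') ≤ 2 * β) (x0 : X) :
    ∃ (j : ℝ) (v : X → ℝ), BddMeasurable (2 * t * C / (1 - β)) v ∧
      |j| ≤ C + 2 * (2 * t * C / (1 - β)) ∧
      (∀ x u, j + v x ≤ c (x, u) + ∫ y, v y ∂(T (x, u))) ∧
      ∀ x, j + v x = c (x, γ.act x) + policyAvg T γ v x := by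
  obtain ⟨j, v, hvm, ⟨K, hK⟩, hv⟩ := h
  have hvb : BddMeasurable K v := ⟨hvm, hK⟩
  have hosc : ∀ x x', |v x - v x'| ≤ 2 * t * C / (1 - β) :=
    -- The undiscounted case; taking `m := -j` removes the unknown constant from the span bound.
    osc_le_of_poisson T γ hβ1 htv (α := 1) (m := -j) (q := fun x => c (x, γ.act x) - j)
      zero_le_one le_rfl hvb (fun x => by simpa using hc.bound (x, γ.act x)) fun x => by
        have := (hv x).2
        simp only [policyAvg]
        linarith
  have hint : ∀ p, ∫ y, (v y - v x0) ∂(T p) = ∫ y, v y ∂(T p) - v x0 := fun p => by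
    rw [integral_sub (hvb.integrable _) (integrable_const _)]; simp
  have hb : BddMeasurable (2 * t * C / (1 - β)) fun x => v x - v x0 :=
    ⟨hvm.sub_const _, fun x => hosc x x0⟩
  have heq : ∀ x, j + (v x - v x0) = c (x, γ.act x) + policyAvg T γ (fun y => v y - v x0) x := by
    intro x
    have := (hv x).2
    simp only [policyAvg, hint]
    linarith
  refine ⟨j, fun x => v x - v x0, hb, ?_, fun x u => ?_, heq⟩
  · have h1 := abs_le.mp (hc.bound (x0, γ.act x0))
    have h2 := abs_le.mp ((hb.policyAvg T γ).bound x0)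
    have h3 := abs_le.mp (hb.bound x0)
    have h4 := heq x0
    rw [abs_le]
    constructor <;> linarith
  · have h1 : bellman c T v x ≤ c (x, u) + ∫ y, v y ∂(T (x, u)) := by
      refine ciInf_le ⟨-C + -K, ?_⟩ u
      rintro _ ⟨u', rfl⟩
      exact add_le_add (abs_le.mp (hc.bound _)).1 (abs_le.mp (hvb.integral_abs_le _)).1
    rw [← (hv x).1] at h1
    rw [hint]
    linarith

lemma optimalAverageCost_le {c : X × U → ℝ} {C : ℝ} (hc : BddMeasurable C c)
    (T : Kernel (X × U) X) [IsMarkovKernel T] (γ : AdmissiblePolicy X U) (x : X) :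
    optimalAverageCost c T x ≤ averageCost c T γ x := by
  refine ciInf_le ⟨-C, ?_⟩ γ
  rintro _ ⟨γ', rfl⟩
  refine le_averageCost_of_forall_le T γ' x hc (M := 0) fun N => ?_
  linarith [(abs_le.mp (abs_expectedCost_le T γ' x hc N)).1]

variable [TopologicalSpace X] [TopologicalSpace U] [BorelSpace X] [BorelSpace U]
  [SecondCountableTopology X] [SecondCountableTopology U] [HasOuterApproxClosed X]
  [CompactSpace U]

/-- Along an ultrafilter, policies solving the optimality equations of the approximating kernels
are asymptotically nearly optimal for the limit kernel. -/
lemma exists_forall_eventually_averageCost_le {c : X × U → ℝ} (hc : Continuous c)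
    (hcb : ∃ C : ℝ, ∀ p, |c p| ≤ C) {T : Kernel (X × U) X} [IsMarkovKernel T]
    {Tn : ℕ → Kernel (X × U) X} [∀ n, IsMarkovKernel (Tn n)]
    (hT_erg : UniformlyErgodic fun _ : Unit => T) (hTn_erg : UniformlyErgodic Tn)
    (hT_cont : Continuous (kernelProb T)) {γn : ℕ → StationaryPolicy X U}
    (hγn : ∀ n, SatisfiesACOE c (Tn n) (γn n)) (x : X) :
    ∃ E : ℝ, 0 ≤ E ∧ ∀ (L : Ultrafilter ℕ), KernelsConvergeContinuously (L : Filter ℕ) Tn T →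
      ∀ ε > 0, ∀ᶠ n in (L : Filter ℕ),
        averageCost c T (γn n).toAdmissible x ≤ optimalAverageCost c T x + E * ε := by
  have : Nonempty X := ⟨x⟩
  have : Nonempty U := ⟨(γn 0).act x⟩
  obtain ⟨C, hC⟩ := id hcb
  have hcB : BddMeasurable C c := ⟨hc.measurable, hC⟩
  obtain ⟨t, -, β, hβ0, hβ1, htv⟩ := id hT_erg
  obtain ⟨t', -, β', -, hβ1', htv'⟩ := hTn_erg
  set Ω := 2 * t' * C / (1 - β') with hΩ
  choose j v hv hj hsub heq using fun n =>
    (hγn n).exists_normalized hcB hβ1' (fun y y' => htv' n (γn n) y y') x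
  have hE0 : 0 ≤ (2 : ℝ) ^ (t' + 2) * 3 / (1 - β') := div_nonneg (by positivity) (by linarith)
  -- The 5 collects `2 * ε` from the defect, `ε` from its limit, `ε` from mixing and `ε` from `r -
  -- ε` being a lower bound. The other term bounds the range of `w`.
  refine ⟨(2 : ℝ) ^ (t' + 2) * 3 / (1 - β') + 5, by linarith, fun L hL ε hε => ?_⟩
  obtain ⟨r, h, g, hlow, hupp⟩ := exists_approx_ACOE hc hcb hT_cont hT_erg hε
  have hh := h.bddMeasurable
  set w : ℕ → X → ℝ := fun n y => v n y - h y with hw_def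
  have hw : ∀ n, BddMeasurable (Ω + ‖h‖) (w n) := fun n => (hv n).sub hh
  have hwA : ∀ n (σ : StationaryPolicy X U) y, policyAvg (Tn n) σ (w n) y =
      policyAvg (Tn n) σ (v n) y - policyAvg (Tn n) σ h y := fun n σ y =>
    congrFun (policyAvg_sub (Tn n) σ (hv n) hh) y
  -- The constants converge along the ultrafilter.
  obtain ⟨d, -, hd⟩ := isCompact_iff_ultrafilter_le_nhds.mp
    (isCompact_Icc (a := r - (C + 2 * Ω)) (b := r + (C + 2 * Ω)))
    (L.map fun n => r - j n) (by
      rw [le_principal_iff]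
      refine mem_map.mpr (univ_mem' fun n => ?_)
      have := abs_le.mp (hj n)
      exact ⟨by linarith, by linarith⟩)
  have hd : Tendsto (fun n => r - j n) (L : Filter ℕ) (𝓝 d) := hd
  have hdn : Tendsto (fun n => -(r - j n)) (L : Filter ℕ) (𝓝 (-d)) := hd.neg
  have hdu := IsAsympUpperBound.of_tendsto (X := X) hd
  have hdl := IsAsympUpperBound.of_tendsto (X := X) hdn
  -- Continuity of `h` allows exchanging `Tn n` and `T` in its integrals, whatever the action.
  have hmerge := fun y δ (hδ : 0 < δ) => hL.eventually_forall_abs_sub_lt hT_cont h y (ε := δ) hδ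
  have hsubw : IsAsympUpperBound (L : Filter ℕ)
      (fun n y => w n y - policyAvg (Tn n) g (w n) y) (d + 2 * ε) := by
    intro y δ hδ
    filter_upwards [hdu y (δ / 2) (by linarith), hmerge y (δ / 2) (by linarith)] with p h1 h2
    have h3 := (abs_lt.mp (h2 (g.act p.2))).2
    have h4 := hsub p.1 p.2 (g.act p.2)
    have h5 := hupp p.2
    rw [hwA]
    simp only [hw_def, policyAvg]
    linarith
  have hsupw : IsAsympUpperBound (L : Filter ℕ)
      (fun n y => policyAvg (Tn n) (γn n) (w n) y - w n y) (-d + ε) := by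
    intro y δ hδ
    filter_upwards [hdl y (δ / 2) (by linarith), hmerge y (δ / 2) (by linarith)] with p h1 h2
    have h3 := (abs_lt.mp (h2 ((γn p.1).act p.2))).1
    have h4 := heq p.1 p.2
    have h5 := hlow p.2 ((γn p.1).act p.2)
    rw [hwA]
    simp only [hw_def, policyAvg] at h4 ⊢
    linarith
  set b := asympSup (L : Filter ℕ) w with hb
  set a := asympSup (L : Filter ℕ) (fun n y => -w n y) with ha
  have hwK : ∀ n y, |w n y| ≤ Ω + ‖h‖ := fun n => (hw n).bound
  have hwK' : ∀ n y, |-w n y| ≤ Ω + ‖h‖ := fun n y => by simpa using hwK n y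
  have hbu : IsAsympUpperBound (L : Filter ℕ) w b := isAsympUpperBound_asympSup hwK
  have hau : IsAsympUpperBound (L : Filter ℕ) (fun n y => -w n y) a :=
    isAsympUpperBound_asympSup hwK'
  have hauA := IsAsympUpperBound.policyAvg hL γn (fun n => (hw n).neg) hau
  simp only [policyAvg_neg] at hauA
  -- Writing `w` as its drift plus its average gives the upper bound `d + 2 * ε + b`, which cannot
  -- lie below the least one, `b`.
  have hd1 : -(2 * ε) ≤ d := by
    have h1 := hbu.policyAvg hL (fun _ => g) hw
    have h2 := asympSup_le hwK ((hsubw.add h1).mono (g := w) (fun n y => by simp) le_rfl)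
    linarith
  have hd2 : d ≤ ε := by
    have h2 := asympSup_le hwK'
      ((hsupw.add hauA).mono (g := fun n y => -w n y) (fun n y => by linarith) le_rfl)
    linarith
  have hspan : b + a ≤ 2 ^ (t' + 2) * (3 * ε) / (1 - β') :=
    asympSup_add_asympSup_neg_le hL hβ1' htv' (fun _ => g) γn (by linarith) hw
      (hsubw.mono (fun _ _ => le_rfl) (by linarith)) (hsupw.mono (fun _ _ => le_rfl) (by linarith))
  -- The defect of `γn n` in the approximate optimality equation of `T`.
  set D : ℕ → X → ℝ := fun n y => c (y, (γn n).act y) + policyAvg T (γn n) h y - r - h y with hD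
  set M := C + ‖h‖ + |r| + ‖h‖ with hM
  have hDb : ∀ n, BddMeasurable M (D n) := fun n =>
    (((show BddMeasurable C fun y => c (y, (γn n).act y) from
      ⟨hcB.measurable.comp (measurable_id.prodMk (γn n).measurable_act),
        fun _ => hcB.bound _⟩).add (hh.policyAvg T (γn n))).sub (BddMeasurable.const r)).sub hh
  -- The equation for `v n` turns the defect into `(j n - r)`, plus `w n` minus its `Tn n`-average,
  -- plus the difference of the `T`- and `Tn n`-averages of `h`.
  have hDu : IsAsympUpperBound (L : Filter ℕ) D (2 * ε + (b + a)) := by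
    intro y δ hδ
    filter_upwards [hdl y (δ / 4) (by linarith), hbu y (δ / 4) (by linarith),
      hauA y (δ / 4) (by linarith), hmerge y (δ / 4) (by linarith)] with p h1 h2 h3 h4
    have h5 := (abs_lt.mp (h4 ((γn p.1).act p.2))).1
    have h6 := heq p.1 p.2
    rw [hwA] at h3
    simp only [hw_def, hD, policyAvg] at h2 h3 h6 ⊢
    linarith
  have hM0 : 0 ≤ M := (abs_nonneg _).trans ((hDb 0).bound x)
  obtain ⟨k, hk⟩ := exists_pow_lt_of_lt_one (show 0 < ε / (2 * M + 1) by positivity) hβ1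
  have hk' : β ^ k * (2 * M) ≤ ε := by
    have h1 : β ^ k * (2 * M + 1) ≤ ε := ((lt_div_iff₀ (by positivity)).mp hk).le
    linarith [pow_nonneg hβ0.le k]
  have hiter := IsAsympUpperBound.policyAvg_iterate
    (kernelsConvergeContinuously_const (L := (L : Filter ℕ)) hT_cont) γn hDb hDu (t * k)
  have hJ : r - ε ≤ optimalAverageCost c T x := by
    have : Nonempty (AdmissiblePolicy X U) := ⟨(γn 0).toAdmissible⟩
    exact le_ciInf fun γ => le_averageCost_of_subsolution T γ x hcB hh fun y u => by
      linarith [hlow y u]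
  filter_upwards [hiter.eventually_lt x hε] with n hn
  -- The limit bound is known at `x` only; the contracted span `β ^ k * (2 * M)` carries it to all
  -- states, and further averaging preserves it.
  have hall : ∀ y, (policyAvg T (γn n))^[t * k] (D n) y ≤ 4 * ε + (b + a) := by
    intro y
    have h1 := abs_policyAvg_iterate_mul_sub_le T (γn n) (fun y y' => htv () (γn n) y y') (hDb n)
      (D := 2 * M) (fun y y' => (abs_sub _ _).trans (by
        linarith [(hDb n).bound y, (hDb n).bound y'])) k y x
    linarith [(abs_le.mp h1).2]
  have hfin := averageCost_le_of_defect T x (γn n) hcB hh (r := r) (ε := 4 * ε + (b + a)) (t * k)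
    fun N hN => by
      obtain ⟨s, rfl⟩ := Nat.exists_eq_add_of_le' hN
      rw [Function.iterate_add_apply]
      exact policyAvg_iterate_le T (γn n) ((hDb n).policyAvg_iterate _ _ _) hall s x
  have he : 2 ^ (t' + 2) * (3 * ε) / (1 - β') = 2 ^ (t' + 2) * 3 / (1 - β') * ε := by ring
  rw [he] at hspan
  linarith

end Main

theorem mainTheorem2 {d m : ℕ}
    (X : Set (EuclideanSpace ℝ (Fin d))) (hX : MeasurableSet X)
    (U : Set (EuclideanSpace ℝ (Fin m))) (hU : IsCompact U)
    (c : ↥X × ↥U → ℝ) (hc : Continuous c) (hcb : ∃ C : ℝ, ∀ p, |c p| ≤ C)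
    (T : Kernel (↥X × ↥U) ↥X) [IsMarkovKernel T]
    (Tn : ℕ → Kernel (↥X × ↥U) ↥X) [∀ n, IsMarkovKernel (Tn n)]
    (hT_erg : UniformlyErgodic fun _ : Unit => T)
    (hTn_erg : UniformlyErgodic Tn)
    (hT_cont : Continuous (kernelProb T))
    (hconv : ∀ (x : ↥X) (u : ↥U) (xn : ℕ → ↥X) (un : ℕ → ↥U),
      Tendsto xn atTop (𝓝 x) → Tendsto un atTop (𝓝 u) →
        Tendsto (fun n => kernelProb (Tn n) (xn n, un n)) atTop (𝓝 (kernelProb T (x, u))))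
    (γn : ℕ → StationaryPolicy ↥X ↥U)
    (hγn : ∀ n, SatisfiesACOE c (Tn n) (γn n)) (x : ↥X) :
    Tendsto (fun n => averageCost c T (γn n).toAdmissible x) atTop
      (𝓝 (optimalAverageCost c T x)) := by
  have : CompactSpace U := isCompact_iff_compactSpace.mp hU
  obtain ⟨E, hE, hmain⟩ := exists_forall_eventually_averageCost_le hc hcb hT_erg hTn_erg hT_cont
    hγn x
  obtain ⟨C, hC⟩ := hcb
  have hle : ∀ n, optimalAverageCost c T x ≤ averageCost c T (γn n).toAdmissible x := fun n =>
    optimalAverageCost_le ⟨hc.measurable, hC⟩ T _ x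
  rw [tendsto_iff_ultrafilter]
  intro L hL
  have hLc : KernelsConvergeContinuously (L : Filter ℕ) Tn T := fun p =>
    (kernelsConvergeContinuously_of_seq hconv p).mono_left (Filter.prod_mono hL le_rfl)
  refine tendsto_order.mpr ⟨fun s hs => Eventually.of_forall fun n => hs.trans_le (hle n),
    fun s hs => ?_⟩
  have hpos : 0 < (s - optimalAverageCost c T x) / (E + 1) := by
    have : 0 < s - optimalAverageCost c T x := sub_pos.mpr hs
    positivity
  filter_upwards [hmain L hLc _ hpos] with n hn
  have h1 : (E + 1) * ((s - optimalAverageCost c T x) / (E + 1)) =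
      s - optimalAverageCost c T x := by field_simp
  linarith
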